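/- Let $\mathbb T^2=(\mathbb R/\mathbb Z)^2$, $\mathcal L=\Delta^2$, and let $e^{-t\mathcal L}$ be the semigroup generated by $\mathcal L$, i.e. the Fourier multiplier with symbol $e^{-t(4\pi^2|k|^2)^2}$, $k\in\mathbb Z^2$ (defined on $L^2(\mathbb T^2)$ for $t\ge 0$ and on $L^1(\mathbb T^2)$ for $t>0$). Consider the equation $$\partial_t u+v\cdot\nabla u+\Delta^2u=-\nabla\cdot(|\nabla u|^{p-2}\nabla u),\qquad u(0)=u_0,$$ for real-valued $u$ on $[0,T]\times\mathbb T^2$, with a given $v\in L^\infty([0,\infty);L^2(\mathbb T^2;\mathbb R^2))$. A mild solution on $[0,T]$ is a function $u\in C([0,T];L^2(\mathbb T^2))$ whose weak spatial gradient $\nabla u$ is integrable on $[0,T]\times\mathbb T^2$, such that $|\nabla u(s)|^{p-2}\nabla u(s)$ and $v(s)\cdot\nabla u(s)$ are integrable on $\mathbb T^2$ for almost every $s\in[0,T]$ and, for every $t\in[0,T]$, $$u(t)=e^{-t\mathcal L}u_0-\int_0^t\nabla\cdot e^{-(t-s)\mathcal L}\big(|\nabla u(s)|^{p-2}\nabla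 u(s)\big)\,ds-\int_0^te^{-(t-s)\mathcal L}\big(v(s)\cdot\nabla u(s)\big)\,ds\quad\text{in }L^2(\mathbb T^2),$$ where both integrals exist as Bochner integrals in $L^2(\mathbb T^2)$. Let $$\tilde{\mathcal S}_T=\Big\{u\in C([0,T];L^2(\mathbb T^2)):\ \sup_{0<t\le T}t^{1/4}\|\nabla u(t)\|_{L^2}<\infty\Big\}.$$ **Theorem.** Let $2<p<3$ and $a,b\ge 0$. There exists $0<T\le 1$, depending only on $p$, $a$ and $b$, such that for all $u_0\in L^2(\mathbb T^2)$ with $\|u_0\|_{L^2}=a$ and all $v\in L^\infty([0,\infty);L^2(\mathbb T^2;\mathbb R^2))$ with $\operatorname{ess\,sup}_{t\ge 0}\|v(t)\|_{L^2}=b$, the equation has a mild solution $u$ on $[0,T]$ with $u\in\tilde{\mathcal S}_T$, and every mild solution on $[0,T]$ (with the same $u_0$ and $v$) belonging to $\tilde{\mathcal S}_T$ coincides with $u$ on $[0,T]$. -/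

import Mathlib

open MeasureTheory Set
open scoped ENNReal NNReal ContDiff

-- The Haar probability measure on `ℝ / ℤ`, as in Mathlib's Fourier analysis on tori.
attribute [local instance] instMeasureSpaceUnitAddCircle
attribute [local instance] instIsProbabilityMeasureUnitAddCircleVolume

namespace ThinFilm

/-- The two-dimensional torus `𝕋² = (ℝ / ℤ)²`, with its normalised Lebesgue measure `volume`. -/
abbrev Torus2 : Type := UnitAddTorus (Fin 2)

/-- `ℝ²` with its Euclidean norm. -/
abbrev Plane : Type := EuclideanSpace ℝ (Fin 2)

/-- The real space `L²(𝕋²)`. -/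
abbrev L2 : Type := Lp ℝ 2 (volume : Measure Torus2)

/-- The space `L²(𝕋²; ℝ²)` of square integrable vector fields. -/
abbrev L2Vec : Type := Lp Plane 2 (volume : Measure Torus2)

/-- The space `L¹(𝕋²; ℝ²)` of integrable vector fields. -/
abbrev L1Vec : Type := Lp Plane 1 (volume : Measure Torus2)

/-! ### Weak gradients -/

/-- A smooth (that is, lifting to a `C^∞` function on `ℝ²`) real function on the torus. -/
def IsSmooth (φ : Torus2 → ℝ) : Prop :=
  ContDiff ℝ ∞ (fun x : Fin 2 → ℝ => φ (fun i => (x i : UnitAddCircle)))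

/-- The classical partial derivative `∂ⱼ φ` of a function on the torus. -/
noncomputable def partialDeriv (j : Fin 2) (φ : Torus2 → ℝ) (y : Torus2) : ℝ :=
  deriv (fun s : ℝ => φ (y + Pi.single j (s : UnitAddCircle))) 0

/-- `g` is the weak (distributional) gradient of `f`, both being integrable on the torus:
`∫ f ∂ⱼφ = - ∫ gⱼ φ` for all smooth `φ` and `j = 1, 2`. -/
structure HasWeakGradient (f : Torus2 → ℝ) (g : Torus2 → Plane) : Prop where
  integrable_fun : Integrable f
  integrable_grad : Integrable g
  integral_eq : ∀ φ : Torus2 → ℝ, IsSmooth φ → ∀ j : Fin 2,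
    ∫ y, f y * partialDeriv j φ y = - ∫ y, g y j * φ y

/-! ### The semigroup generated by `ℒ = Δ²` -/

/-- The inverse Fourier transform `𝓕⁻¹ c = ∑ₖ c(k) e^{2πi k·x}` of a square summable family with
`c(-k) = conj (c k)`, as an element of real `L²(𝕋²)`; the series is unconditionally convergent in
complex `L²`, and its sum is real-valued by the symmetry of `c`, so that taking the real part only
moves it to the real space. -/
noncomputable def invFourier (c : (Fin 2 → ℤ) → ℂ) : L2 :=
  Complex.reCLM.compLp (∑' k : Fin 2 → ℤ, c k • UnitAddTorus.mFourierLp 2 k)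

/-- The Fourier coefficient `f̂(k) = ∫ f(x) e^{-2πi k·x} dx` of a real function. -/
noncomputable def coeff (f : Torus2 → ℝ) (k : Fin 2 → ℤ) : ℂ :=
  UnitAddTorus.mFourierCoeff (fun x => (f x : ℂ)) k

/-- The symbol `(4π²|k|²)²` of `ℒ = Δ²` on the torus `(ℝ / ℤ)²`. -/
noncomputable def bilaplacianSymbol (k : Fin 2 → ℤ) : ℝ :=
  (4 * Real.pi ^ 2 * ∑ j, (k j : ℝ) ^ 2) ^ 2

/-- The semigroup `e^{-tℒ} f`, as a Fourier multiplier. Meaningful for `f ∈ L²` and `t ≥ 0`, and for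
`f ∈ L¹` and `t > 0`. -/
noncomputable def semigroup (t : ℝ) (f : Torus2 → ℝ) : L2 :=
  invFourier fun k => (Real.exp (-t * bilaplacianSymbol k) : ℂ) * coeff f k

/-- `∇ · e^{-tℒ} F = ∑ⱼ ∂ⱼ e^{-tℒ} Fⱼ` for an integrable vector field `F` and `t > 0`, where `∂ⱼ` has
the symbol `2πi kⱼ`. -/
noncomputable def divSemigroup (t : ℝ) (F : Torus2 → Plane) : L2 :=
  invFourier fun k => ∑ j : Fin 2, (2 * Real.pi * Complex.I * (k j : ℂ)) *
    ((Real.exp (-t * bilaplacianSymbol k) : ℂ) * coeff (fun x => F x j) k)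

/-! ### Mild solutions -/

/-- The nonlinearity `|ξ|^{p-2} ξ`. -/
noncomputable def flux (p : ℝ) (ξ : Plane) : Plane := ‖ξ‖ ^ (p - 2) • ξ

/-- `u : [0,T] → L²(𝕋²)` is a mild solution on `[0,T]` of
`∂ₜ u + v·∇u + Δ² u = - ∇·(|∇u|^{p-2} ∇u)`, `u(0) = u₀`.
Here `G` is the spatial weak gradient of `u`, integrable in space-time: it lies in
`L¹(0,T; L¹(𝕋²; ℝ²))`. The integrands must make sense (`|∇u|^{p-2} ∇u` and `v·∇u` are integrable on
the torus at almost every time) and be Bochner integrable with values in `L²(𝕋²)`. -/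
structure IsMildSolution (p : ℝ) (v : ℝ → L2Vec) (u₀ : L2) (T : ℝ) (u : ℝ → L2) : Prop where
  continuousOn : ContinuousOn u (Icc 0 T)
  duhamel : ∃ G : ℝ → L1Vec,
    LocallyIntegrableOn G (Icc 0 T) ∧
    (∀ᵐ s ∂(volume.restrict (Icc 0 T)), HasWeakGradient (u s) (G s)) ∧
    (∀ᵐ s ∂(volume.restrict (Icc 0 T)), Integrable (fun x => flux p (G s x))) ∧
    (∀ᵐ s ∂(volume.restrict (Icc 0 T)), Integrable (fun x => inner ℝ (v s x) (G s x))) ∧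
    ∀ t ∈ Icc 0 T,
      IntervalIntegrable (fun s => divSemigroup (t - s) (fun x => flux p (G s x))) volume 0 t ∧
      IntervalIntegrable (fun s => semigroup (t - s) (fun x => inner ℝ (v s x) (G s x)))
        volume 0 t ∧
      u t = semigroup t u₀
        - (∫ s in (0 : ℝ)..t, divSemigroup (t - s) (fun x => flux p (G s x)))
        - ∫ s in (0 : ℝ)..t, semigroup (t - s) (fun x => inner ℝ (v s x) (G s x))

/-- The weighted space `S̃_T = C([0,T]; L²) ∩ {u : sup_{0 < t ≤ T} t^{1/4} ‖∇u(t)‖_{L²} < ∞}`. -/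
def MemWeightedSpace (T : ℝ) (u : ℝ → L2) : Prop :=
  ContinuousOn u (Icc 0 T) ∧
    ∃ M : ℝ≥0, ∀ t ∈ Ioc 0 T, ∃ g : Torus2 → Plane, HasWeakGradient (u t) g ∧
      ENNReal.ofReal (t ^ (1 / 4 : ℝ)) * eLpNorm g 2 volume ≤ M

/-- The norm of `v` in `L^∞([0,∞); L²(𝕋²; ℝ²))`, the essential supremum of `‖v(t)‖_{L²}`. -/
noncomputable def velocityNorm (v : ℝ → L2Vec) : ℝ :=
  (eLpNorm v ∞ (volume.restrict (Ici (0 : ℝ)))).toReal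

end ThinFilm

namespace ThinFilm

open UnitAddTorus Filter Topology
open scoped ComplexConjugate

/-! ### Fourier coefficients and Fourier synthesis -/

/-! The unknown of the fixed point problem is the gradient `G = ∇u`, sought with `‖G(s)‖ ≤ M
s^(-1/4)` in `L²`; this is the rate at which `∇e^{-sℒ}` maps `L²` to `L²` (`gradBound_heat_coeff`).
Since `p - 1 < 2` and the torus has measure one, the flux is in `L¹` with norm of order
`s^(-(p-1)/4)`, and by Cauchy–Schwarz `v·G` is in `L¹` with norm of order `s^(-1/4)`. `L¹` enters
only through the boundedness of Fourier coefficients: in dimension two, `m` derivatives of `e^{-rℒ}`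
map `L¹` to `L²` with norm of order `r^(-(m+1)/4)` (`sum_kernel_le`). The gradient of the flux term
has `m = 2`, so it costs the time integral of `(t-s)^(-3/4) s^(-(p-1)/4)`, which is of order
`t^(-1/4) t^((3-p)/4)`. Because `p < 3`, a positive power is left over: the problem is subcritical.

The spare power is not spent on making `T` small. Differences are measured with an extra weight
`e^{ls}`, and `exp_mul_kernel_le` converts the spare exponent into a factor `l^(-(3-p)/4)`. Hence
`gradBound_duhamel_sub` makes the Duhamel map a contraction on a ball of any radius `M`, once `l` is
large depending on `p`, `b`, `M`; the required Lipschitz bound for the flux in `L¹` is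
`integral_norm_flux_sub_le`.

For existence, `M` is fixed by `a`, then `l`, and `T` is only used to keep `e^{lT} ≤ 2`, so that the
ball is preserved; Picard iteration gives `Setting.exists_fixedPoint`. For uniqueness, `M` and `l`
are chosen after two solutions are given, with the same `T`: iterating the contraction shows that
the gradients agree, hence the solutions do (`eqOn_of_isMildSolution`). The gradient in the
definition of a mild solution is only in `L¹`, so it is identified with the square integrable one
through the injectivity of the Fourier transform on `L¹`. -/

theorem coeff_def (f : Torus2 → ℝ) (k : Fin 2 → ℤ) :
    coeff f k = ∫ x, mFourier (-k) x * (f x : ℂ) := rfl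

theorem norm_mFourier_apply (k : Fin 2 → ℤ) (x : Torus2) : ‖mFourier k x‖ = 1 := by
  simp [mFourier, fourier_apply, Circle.norm_coe]

theorem coeff_congr {f g : Torus2 → ℝ} (h : f =ᵐ[volume] g) (k : Fin 2 → ℤ) :
    coeff f k = coeff g k := by
  rw [coeff_def, coeff_def]
  refine integral_congr_ae ?_
  filter_upwards [h] with x hx
  rw [hx]

theorem integrable_mFourier_mul {f : Torus2 → ℂ} (hf : Integrable f) (k : Fin 2 → ℤ) :
    Integrable (fun x => mFourier k x * f x) :=
  hf.bdd_mul (c := 1) (mFourier k).continuous.aestronglyMeasurable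
    (ae_of_all _ fun x => (norm_mFourier_apply k x).le)

theorem integrable_complex_ofReal {f : Torus2 → ℝ} (hf : Integrable f) :
    Integrable (fun x => (f x : ℂ)) := hf.ofReal

theorem coeff_sub {f g : Torus2 → ℝ} (hf : Integrable f) (hg : Integrable g) (k : Fin 2 → ℤ) :
    coeff (fun x => f x - g x) k = coeff f k - coeff g k := by
  simp only [coeff_def]
  rw [← integral_sub (integrable_mFourier_mul (integrable_complex_ofReal hf) _)
    (integrable_mFourier_mul (integrable_complex_ofReal hg) _)]
  congr 1
  ext x
  push_cast
  ring

theorem norm_coeff_le (f : Torus2 → ℝ) (k : Fin 2 → ℤ) : ‖coeff f k‖ ≤ ∫ x, ‖f x‖ := by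
  rw [coeff_def]
  refine (norm_integral_le_integral_norm _).trans_eq ?_
  simp [norm_mFourier_apply]

theorem coeff_neg (f : Torus2 → ℝ) (k : Fin 2 → ℤ) : coeff f (-k) = conj (coeff f k) := by
  rw [coeff_def, coeff_def, ← integral_conj]
  congr 1
  ext x
  rw [map_mul, ← mFourier_neg, Complex.conj_ofReal]

/-- The complexification `L²(𝕋²; ℝ) → L²(𝕋²; ℂ)`. -/
noncomputable def complexify : L2 →L[ℝ] Lp ℂ 2 (volume : Measure Torus2) :=
  Complex.ofRealCLM.compLpL 2 volume

theorem coeff_eq_repr (f : L2) (k : Fin 2 → ℤ) :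
    coeff f k = mFourierBasis.repr (complexify f) k := by
  rw [mFourierBasis_repr, coeff, mFourierCoeff, mFourierCoeff]
  refine integral_congr_ae ?_
  filter_upwards [Complex.ofRealCLM.coeFn_compLpL (p := 2) f] with x hx
  rw [complexify, hx, Complex.ofRealCLM_apply]

/-- The `k`-th Fourier coefficient as a continuous functional on `L²`. -/
noncomputable def coeffCLM (k : Fin 2 → ℤ) : L2 →L[ℝ] ℂ :=
  ((lp.evalCLM ℂ (fun _ : Fin 2 → ℤ => ℂ) 2 k).restrictScalars ℝ).comp
    ((mFourierBasis.repr.toContinuousLinearEquiv.toContinuousLinearMap.restrictScalars ℝ).comp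
      complexify)

theorem coeffCLM_apply (k : Fin 2 → ℤ) (f : L2) : coeffCLM k f = coeff f k := by
  rw [coeff_eq_repr]; rfl

/-- Fourier synthesis `ℓ² → L²(𝕋²; ℝ)`. -/
noncomputable def synthesis : lp (fun _ : Fin 2 → ℤ => ℂ) 2 →L[ℝ] L2 :=
  (Complex.reCLM.compLpL 2 volume).comp
    (mFourierBasis.repr.symm.toContinuousLinearEquiv.toContinuousLinearMap.restrictScalars ℝ)

theorem invFourier_eq_synthesis (c : lp (fun _ : Fin 2 → ℤ => ℂ) 2) :
    invFourier c = synthesis c := by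
  have h := mFourierBasis.hasSum_repr_symm c
  simp only [coe_mFourierBasis] at h
  rw [invFourier, h.tsum_eq]
  rfl

theorem memlp_of_summable {c : (Fin 2 → ℤ) → ℂ} (hc : Summable fun k => ‖c k‖ ^ 2) :
    Memℓp c 2 := by
  rw [memℓp_gen_iff (by norm_num)]
  simpa using hc

theorem norm_reCLM_compLp_le (f : Lp ℂ 2 (volume : Measure Torus2)) :
    ‖Complex.reCLM.compLp f‖ ≤ ‖f‖ := by
  refine (ContinuousLinearMap.norm_compLp_le _ _).trans ?_
  rw [Complex.reCLM_norm, one_mul]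

theorem summable_of_sum_le {c : (Fin 2 → ℤ) → ℂ} {K : ℝ}
    (h : ∀ S : Finset (Fin 2 → ℤ), ∑ k ∈ S, ‖c k‖ ^ 2 ≤ K ^ 2) :
    Summable fun k => ‖c k‖ ^ 2 :=
  _root_.summable_of_sum_le (fun _ => by positivity) h

theorem norm_invFourier_le {c : (Fin 2 → ℤ) → ℂ} {K : ℝ} (hK : 0 ≤ K)
    (h : ∀ S : Finset (Fin 2 → ℤ), ∑ k ∈ S, ‖c k‖ ^ 2 ≤ K ^ 2) : ‖invFourier c‖ ≤ K := by
  have hc := memlp_of_summable (summable_of_sum_le h)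
  set d : lp (fun _ : Fin 2 → ℤ => ℂ) 2 := ⟨c, hc⟩
  change ‖invFourier d‖ ≤ K
  rw [invFourier_eq_synthesis]
  refine (norm_reCLM_compLp_le _).trans ?_
  have : ‖mFourierBasis.repr.symm d‖ ≤ K := by
    rw [LinearIsometryEquiv.norm_map]
    refine lp.norm_le_of_forall_sum_le (by norm_num) hK fun S => ?_
    simpa using h S
  exact this

theorem summable_sq_mul {c : (Fin 2 → ℤ) → ℂ} (hc : Summable fun k => ‖c k‖ ^ 2)
    {m : (Fin 2 → ℤ) → ℂ} (hm : ∀ k, ‖m k‖ ≤ 1) : Summable fun k => ‖m k * c k‖ ^ 2 := by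
  refine hc.of_nonneg_of_le (fun _ => by positivity) fun k => ?_
  rw [norm_mul]
  gcongr
  exact mul_le_of_le_one_left (norm_nonneg _) (hm k)

theorem invFourier_sub {c d : (Fin 2 → ℤ) → ℂ} (hc : Summable fun k => ‖c k‖ ^ 2)
    (hd : Summable fun k => ‖d k‖ ^ 2) :
    invFourier (fun k => c k - d k) = invFourier c - invFourier d := by
  set c' : lp (fun _ : Fin 2 → ℤ => ℂ) 2 := ⟨c, memlp_of_summable hc⟩
  set d' : lp (fun _ : Fin 2 → ℤ => ℂ) 2 := ⟨d, memlp_of_summable hd⟩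
  change invFourier (c' - d' : lp (fun _ : Fin 2 → ℤ => ℂ) 2) = invFourier c' - invFourier d'
  simp only [invFourier_eq_synthesis, map_sub]

theorem hasSum_invFourier {c : (Fin 2 → ℤ) → ℂ} (hc : Summable fun k => ‖c k‖ ^ 2) :
    HasSum (fun k => Complex.reCLM.compLpL 2 volume (c k • mFourierLp 2 k)) (invFourier c) := by
  set c' : lp (fun _ : Fin 2 → ℤ => ℂ) 2 := ⟨c, memlp_of_summable hc⟩
  have h := mFourierBasis.hasSum_repr_symm c'
  simp only [coe_mFourierBasis] at h
  change HasSum _ (invFourier c')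
  rw [invFourier_eq_synthesis]
  exact h.mapL (Complex.reCLM.compLpL 2 volume)

theorem coeff_re {f : Torus2 → ℂ} (hf : Integrable f) (k : Fin 2 → ℤ) :
    coeff (fun x => (f x).re) k =
      (mFourierCoeff f k + conj (mFourierCoeff f (-k))) / 2 := by
  rw [coeff_def, mFourierCoeff, mFourierCoeff, ← integral_conj, ← integral_add, ← integral_div]
  · congr 1
    ext x
    simp only [smul_eq_mul, map_mul, mFourier_neg, neg_neg,
      Complex.re_eq_add_conj]
    ring
  · exact integrable_mFourier_mul hf _
  · exact (Complex.conjLIE.integrable_comp_iff.2 (integrable_mFourier_mul hf _))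

/-- `c` satisfies the symmetry of the Fourier coefficients of a real function. -/
def IsHermitianSeq (c : (Fin 2 → ℤ) → ℂ) : Prop := ∀ k, c (-k) = conj (c k)

/-- For a Hermitian sequence the sum of the series is already real, so the real part in `invFourier`
loses nothing; without the symmetry only the symmetrised coefficients would come back. -/
theorem coeff_invFourier {c : (Fin 2 → ℤ) → ℂ} (hc : Summable fun k => ‖c k‖ ^ 2)
    (hs : IsHermitianSeq c) (k : Fin 2 → ℤ) : coeff (invFourier c) k = c k := by
  set c' : lp (fun _ : Fin 2 → ℤ => ℂ) 2 := ⟨c, memlp_of_summable hc⟩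
  change coeff (invFourier c') k = c' k
  rw [invFourier_eq_synthesis]
  set h := mFourierBasis.repr.symm c'
  have h1 : ((synthesis c' : L2) : Torus2 → ℝ) =ᵐ[volume] fun x => (h x).re :=
    Complex.reCLM.coeFn_compLpL (p := 2) h
  have h2 : ∀ n, mFourierCoeff h n = c n := fun n => by
    rw [← mFourierBasis_repr, LinearIsometryEquiv.apply_symm_apply]
  rw [coeff_congr h1, coeff_re ((Lp.memLp h).integrable one_le_two), h2, h2, hs,
    Complex.conj_conj]
  change _ = c k
  ring

theorem summable_coeff (f : L2) : Summable fun k => ‖coeff f k‖ ^ 2 := by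
  simpa only [coeff_eq_repr, mFourierBasis_repr]
    using (hasSum_sq_mFourierCoeff (complexify f)).summable

theorem isHermitianSeq_coeff (f : Torus2 → ℝ) : IsHermitianSeq (coeff f) := coeff_neg f

theorem invFourier_coeff (f : L2) : invFourier (coeff f) = f := by
  have h := hasSum_mFourier_series_L2 (complexify f)
  simp only [← mFourierBasis_repr, ← coeff_eq_repr] at h
  rw [invFourier, h.tsum_eq]
  refine Lp.ext ?_
  filter_upwards [Complex.reCLM.coeFn_compLp (complexify f),
    Complex.ofRealCLM.coeFn_compLpL (p := 2) f] with x h1 h2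
  rw [h1, complexify, h2]
  simp

theorem sum_norm_coeff_le (f : L2) (S : Finset (Fin 2 → ℤ)) :
    ∑ k ∈ S, ‖coeff f k‖ ^ 2 ≤ ‖f‖ ^ 2 := by
  have h := mFourierBasis.orthonormal.sum_inner_products_le (complexify f) (s := S)
  simp only [← HilbertBasis.repr_apply_apply, ← coeff_eq_repr] at h
  refine h.trans ?_
  gcongr
  refine (ContinuousLinearMap.norm_compLp_le _ _).trans ?_
  rw [Complex.ofRealCLM_norm, one_mul]

/-! ### Injectivity of the Fourier transform on integrable functions. -/

/-- Integration against `g` is a functional on `C(𝕋²)` bounded by the `L¹` norm of `g`. It vanishes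
on the exponentials, whose span is dense, hence everywhere. -/
theorem integral_mul_eq_zero_of_coeff {g : Torus2 → ℝ} (hg : Integrable g)
    (h : ∀ k, coeff g k = 0) (φ : C(Torus2, ℂ)) : ∫ x, φ x * (g x : ℂ) = 0 := by
  have hint : ∀ φ : C(Torus2, ℂ), Integrable fun x => φ x * (g x : ℂ) := fun φ =>
    hg.ofReal.bdd_mul (c := ‖φ‖) φ.continuous.aestronglyMeasurable
      (ae_of_all _ fun x => φ.norm_coe_le_norm x)
  let A : C(Torus2, ℂ) →ₗ[ℂ] ℂ :=
    { toFun := fun φ => ∫ x, φ x * (g x : ℂ)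
      map_add' := fun φ ψ => by
        rw [← integral_add (hint φ) (hint ψ)]
        simp only [ContinuousMap.add_apply, add_mul]
      map_smul' := fun c φ => by
        simp only [ContinuousMap.smul_apply, smul_eq_mul, mul_assoc, RingHom.id_apply]
        exact integral_const_mul c _ }
  have hA : ∀ φ, ‖A φ‖ ≤ (∫ x, ‖g x‖) * ‖φ‖ := fun φ => by
    refine (norm_integral_le_integral_norm _).trans ?_
    rw [← integral_mul_const]
    refine integral_mono (hint φ).norm (hg.norm.mul_const _) fun x => ?_
    simp only [norm_mul, Complex.norm_real]
    rw [mul_comm]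
    gcongr
    exact φ.norm_coe_le_norm x
  let A' := A.mkContinuous _ hA
  have hsub : Submodule.span ℂ (range (mFourier (d := Fin 2))) ≤ A.ker := by
    rw [Submodule.span_le]
    rintro _ ⟨k, rfl⟩
    have := h (-k)
    rw [coeff_def, neg_neg] at this
    exact this
  have hcl : (Submodule.span ℂ (range (mFourier (d := Fin 2)))).topologicalClosure ≤ A.ker :=
    Submodule.topologicalClosure_minimal _ hsub A'.isClosed_ker
  rw [span_mFourier_closure_eq_top] at hcl
  exact hcl (Submodule.mem_top (x := φ))

/-- An integrable function with vanishing Fourier coefficients vanishes. -/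
theorem ae_eq_zero_of_coeff {g : Torus2 → ℝ} (hg : Integrable g)
    (h : ∀ k, coeff g k = 0) : g =ᵐ[volume] 0 := by
  wlog hm : Measurable g generalizing g
  · have hae := hg.aestronglyMeasurable.aemeasurable.ae_eq_mk
    exact hae.trans (this (hg.congr hae) (fun k => by rw [← h k]; exact (coeff_congr hae k).symm)
      hg.aestronglyMeasurable.aemeasurable.measurable_mk)
  -- The positive and negative parts are densities of two finite measures with the same integrals
  -- against continuous functions. The measures coincide, so the densities agree almost everywhere.
  set P : Torus2 → ℝ≥0 := fun x => (g x).toNNReal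
  set N : Torus2 → ℝ≥0 := fun x => (-g x).toNNReal
  have hP : Measurable P := hm.real_toNNReal
  have hN : Measurable N := hm.neg.real_toNNReal
  have hPi : Integrable fun x => (P x : ℝ) := hg.real_toNNReal
  have hNi : Integrable fun x => (N x : ℝ) := hg.neg.real_toNNReal
  have hPl : ∫⁻ x, (P x : ℝ≥0∞) ≠ ⊤ := by
    have := hPi.lintegral_lt_top
    simpa using this.ne
  have hNl : ∫⁻ x, (N x : ℝ≥0∞) ≠ ⊤ := by
    have := hNi.lintegral_lt_top
    simpa using this.ne
  have := isFiniteMeasure_withDensity hPl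
  have := isFiniteMeasure_withDensity hNl
  have heq : volume.withDensity (fun x => (P x : ℝ≥0∞)) =
      volume.withDensity (fun x => (N x : ℝ≥0∞)) := by
    refine ext_of_forall_integral_eq_of_IsFiniteMeasure fun φ => ?_
    rw [integral_withDensity_eq_integral_smul hP, integral_withDensity_eq_integral_smul hN]
    have hb : ∀ Q : Torus2 → ℝ≥0, Integrable (fun x => (Q x : ℝ)) →
        Integrable fun x => Q x • φ x := fun Q hQ => by
      have := hQ.mul_bdd (c := ‖φ‖) φ.continuous.aestronglyMeasurable
        (ae_of_all _ fun x => φ.norm_coe_le_norm x)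
      exact this
    rw [← sub_eq_zero, ← integral_sub (hb P hPi) (hb N hNi)]
    have h0 := integral_mul_eq_zero_of_coeff hg h
      ⟨fun x => (φ x : ℂ), Complex.continuous_ofReal.comp φ.continuous⟩
    simp only [ContinuousMap.coe_mk, ← Complex.ofReal_mul] at h0
    rw [integral_complex_ofReal] at h0
    rw [← Complex.ofReal_eq_zero, ← h0]
    congr 2
    ext x
    simp only [NNReal.smul_def, smul_eq_mul, P, N, Real.coe_toNNReal']
    rw [← sub_mul, max_zero_sub_max_neg_zero_eq_self, mul_comm]
  rw [withDensity_eq_iff hP.coe_nnreal_ennreal.aemeasurable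
    hN.coe_nnreal_ennreal.aemeasurable hPl] at heq
  filter_upwards [heq] with x hx
  have hx' : (P x : ℝ) = N x := by exact_mod_cast hx
  simp only [P, N, Real.coe_toNNReal'] at hx'
  rw [← max_zero_sub_max_neg_zero_eq_self (g x), hx', sub_self]
  rfl

theorem ae_eq_of_coeff {f g : Torus2 → ℝ} (hf : Integrable f) (hg : Integrable g)
    (h : ∀ k, coeff f k = coeff g k) : f =ᵐ[volume] g := by
  have := ae_eq_zero_of_coeff (hf.sub hg) fun k => by
    change coeff (fun x => f x - g x) k = 0
    rw [coeff_sub hf hg, h, sub_self]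
  filter_upwards [this] with x hx
  exact sub_eq_zero.1 hx

end ThinFilm

namespace ThinFilm

/-! ### The heat kernel of `Δ²` on the frequency side -/

/-- `2π|k|`, the symbol of `√(-Δ)`. -/
noncomputable def freq (k : Fin 2 → ℤ) : ℝ := 2 * Real.pi * √(∑ j, (k j : ℝ) ^ 2)

theorem freq_nonneg (k : Fin 2 → ℤ) : 0 ≤ freq k := by unfold freq; positivity

theorem freq_sq (k : Fin 2 → ℤ) : freq k ^ 2 = 4 * Real.pi ^ 2 * ∑ j, (k j : ℝ) ^ 2 := by
  rw [freq, mul_pow, Real.sq_sqrt (by positivity)]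
  ring

theorem bilaplacianSymbol_eq (k : Fin 2 → ℤ) : bilaplacianSymbol k = freq k ^ 4 := by
  rw [bilaplacianSymbol, ← freq_sq]
  ring

theorem bilaplacianSymbol_nonneg (k : Fin 2 → ℤ) : 0 ≤ bilaplacianSymbol k := by
  unfold bilaplacianSymbol; positivity

theorem two_pi_abs_le_freq (k : Fin 2 → ℤ) (j : Fin 2) :
    2 * Real.pi * |(k j : ℝ)| ≤ freq k := by
  unfold freq
  gcongr
  apply Real.abs_le_sqrt
  exact Finset.single_le_sum (f := fun j => (k j : ℝ) ^ 2) (fun _ _ => by positivity)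
    (Finset.mem_univ j)

theorem abs_add_abs_le_freq (k : Fin 2 → ℤ) : |(k 0 : ℝ)| + |(k 1 : ℝ)| ≤ freq k := by
  have h0 := two_pi_abs_le_freq k 0
  have h1 := two_pi_abs_le_freq k 1
  have := Real.pi_gt_three
  nlinarith [abs_nonneg (k 0 : ℝ), abs_nonneg (k 1 : ℝ)]

theorem sum_exp_abs_le {q : ℝ} (hq : 0 < q) (hq1 : q ≤ 1) (t : Finset ℤ) :
    ∑ n ∈ t, Real.exp (-q * |(n : ℝ)|) ≤ 4 / q := by
  set ρ := Real.exp (-q)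
  have hρ0 : 0 < ρ := Real.exp_pos _
  have hρ1 : ρ < 1 := by rw [← Real.exp_zero]; exact Real.exp_lt_exp.2 (by linarith)
  have hg := hasSum_geometric_of_lt_one hρ0.le hρ1
  have hsum : HasSum (fun n : ℤ => Real.exp (-q * |(n : ℝ)|)) ((1 - ρ)⁻¹ + ρ * (1 - ρ)⁻¹) := by
    refine HasSum.of_nat_of_neg_add_one ?_ ?_
    · refine hg.congr_fun fun n => ?_
      rw [← Real.exp_nat_mul]
      simp [mul_comm]
    · refine (hg.mul_left ρ).congr_fun fun n => ?_
      rw [← Real.exp_nat_mul, ← Real.exp_add]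
      congr 1
      push_cast
      rw [abs_neg, abs_of_nonneg (by positivity)]
      ring
  refine (sum_le_hasSum t (fun _ _ => (Real.exp_pos _).le) hsum).trans ?_
  -- From `e^q ≥ 1 + q` one gets `1 - ρ ≥ q / (1 + q)`, and `q ≤ 1` bounds this below by `q / 2`.
  have h1 : q / 2 ≤ 1 - ρ := by
    have h2 : 1 + q ≤ Real.exp q := by linarith [Real.add_one_le_exp q]
    have h3 : ρ * Real.exp q = 1 := by
      rw [← Real.exp_add]; simp
    nlinarith
  have h4 : (1 - ρ)⁻¹ ≤ 2 / q := by
    rw [inv_le_comm₀ (by linarith) (by positivity), inv_div]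
    exact h1
  have h5 : 0 ≤ (1 - ρ)⁻¹ := inv_nonneg.2 (by linarith)
  calc _ ≤ (1 - ρ)⁻¹ + 1 * (1 - ρ)⁻¹ := by gcongr
    _ ≤ 2 / q + 1 * (2 / q) := by gcongr
    _ = 4 / q := by ring

/-- As `freq k` dominates `|k₀| + |k₁|`, the exponential is at most a product over the coordinates.
Enlarging `S` to a box turns the sum into a product of two geometric series, whence the square. -/
theorem sum_exp_freq_le {q : ℝ} (hq : 0 < q) (hq1 : q ≤ 1) (S : Finset (Fin 2 → ℤ)) :
    ∑ k ∈ S, Real.exp (-(q * freq k)) ≤ (4 / q) ^ 2 := by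
  classical
  let t : Fin 2 → Finset ℤ := fun j => S.image fun k => k j
  calc ∑ k ∈ S, Real.exp (-(q * freq k))
      ≤ ∑ k ∈ S, ∏ j, Real.exp (-q * |(k j : ℝ)|) := by
        gcongr with k
        rw [Fin.prod_univ_two, ← Real.exp_add]
        gcongr
        nlinarith [abs_add_abs_le_freq k]
    _ ≤ ∑ k ∈ Fintype.piFinset t, ∏ j, Real.exp (-q * |(k j : ℝ)|) := by
        refine Finset.sum_le_sum_of_subset_of_nonneg (fun k hk => ?_)
          fun _ _ _ => Finset.prod_nonneg fun _ _ => (Real.exp_pos _).le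
        exact Fintype.mem_piFinset.2 fun j => Finset.mem_image_of_mem _ hk
    _ = ∏ j, ∑ n ∈ t j, Real.exp (-q * |(n : ℝ)|) := 
        (Finset.prod_univ_sum t fun _ n => Real.exp (-q * |(n : ℝ)|)).symm
    _ ≤ ∏ _j : Fin 2, (4 / q) :=
        Finset.prod_le_prod (fun _ _ => Finset.sum_nonneg fun _ _ => (Real.exp_pos _).le)
          fun j _ => sum_exp_abs_le hq hq1 _
    _ = (4 / q) ^ 2 := by rw [Finset.prod_const, Finset.card_univ, Fintype.card_fin]

/-- The quartic decay beats `e^{-2x}` up to `e²`, because `x ≤ 1 + x⁴`. One factor `e^{-x}` absorbs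
`x^m ≤ m! e^x` and the other is kept for summation. -/
theorem pow_mul_exp_le (m : ℕ) {x : ℝ} (hx : 0 ≤ x) :
    x ^ m * Real.exp (-(2 * x ^ 4)) ≤ m.factorial * Real.exp 2 * Real.exp (-x) := by
  have h1 : x ^ m ≤ m.factorial * Real.exp x := by
    have := Real.pow_div_factorial_le_exp x hx m
    rwa [div_le_iff₀' (by positivity)] at this
  have h2 : Real.exp (-(2 * x ^ 4)) ≤ Real.exp 2 * Real.exp (-(2 * x)) := by
    rw [← Real.exp_add]
    gcongr
    nlinarith [sq_nonneg (x ^ 2 - 1), sq_nonneg (x - 1), sq_nonneg (x ^ 2 - x), sq_nonneg x]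
  calc x ^ m * Real.exp (-(2 * x ^ 4))
      ≤ (m.factorial * Real.exp x) * (Real.exp 2 * Real.exp (-(2 * x))) := by gcongr
    _ = m.factorial * Real.exp 2 * (Real.exp x * Real.exp (-(2 * x))) := by ring
    _ = _ := by rw [← Real.exp_add]; ring_nf

/-- The constant of the kernel bound `sum_kernel_le`. -/
noncomputable def kernelConst (m : ℕ) : ℝ := 4 * Real.exp 1 * (2 * m).factorial

theorem kernelConst_pos (m : ℕ) : 0 < kernelConst m := by unfold kernelConst; positivity

/-- This is the smoothing estimate from `L¹` to `L²` for `m` derivatives. Rescaling by `q = r^(1/4)`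
makes each term `q^(-2m)` times a function of `q · freq k`, and about `q^(-2)` lattice points
contribute: this gives the extra `1` in the exponent. -/
theorem sum_kernel_le (m : ℕ) {r : ℝ} (hr : 0 < r) (hr1 : r ≤ 1) (S : Finset (Fin 2 → ℤ)) :
    ∑ k ∈ S, (freq k ^ m * Real.exp (-r * bilaplacianSymbol k)) ^ 2 ≤
      (kernelConst m * r ^ (-((m + 1 : ℝ) / 4))) ^ 2 := by
  set q : ℝ := r ^ (1 / 4 : ℝ)
  have hq : 0 < q := Real.rpow_pos_of_pos hr _
  have hq1 : q ≤ 1 := Real.rpow_le_one hr.le hr1 (by norm_num)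
  have hq4 : q ^ 4 = r := by
    rw [← Real.rpow_natCast, ← Real.rpow_mul hr.le]; norm_num
  have hqm : r ^ (-((m + 1 : ℝ) / 4)) = (q ^ (m + 1))⁻¹ := by
    rw [← Real.rpow_natCast, ← Real.rpow_mul hr.le, ← Real.rpow_neg hr.le]
    push_cast; ring_nf
  have hterm : ∀ k, (freq k ^ m * Real.exp (-r * bilaplacianSymbol k)) ^ 2 ≤
      ((2 * m).factorial * Real.exp 2 * (q ^ (2 * m))⁻¹) * Real.exp (-(q * freq k)) := fun k => by
    have := pow_mul_exp_le (2 * m) (mul_nonneg hq.le (freq_nonneg k))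
    have h2 : (freq k ^ m * Real.exp (-r * bilaplacianSymbol k)) ^ 2 =
        (q ^ (2 * m))⁻¹ * ((q * freq k) ^ (2 * m) * Real.exp (-(2 * (q * freq k) ^ 4))) := by
      rw [mul_pow (freq k ^ m), ← Real.exp_nat_mul, bilaplacianSymbol_eq,
        mul_pow q, mul_pow q, hq4, ← pow_mul, mul_comm m 2]
      field_simp
      push_cast
      ring_nf
    rw [h2]
    calc _ ≤ (q ^ (2 * m))⁻¹ *
          ((2 * m).factorial * Real.exp 2 * Real.exp (-(q * freq k))) := by gcongr
      _ = _ := by ring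
  -- The factorial is wastefully squared only to make the final bound a perfect square.
  have hf : ((2 * m).factorial : ℝ) ≤ (2 * m).factorial ^ 2 := by
    have : (1 : ℝ) ≤ (2 * m).factorial := by exact_mod_cast Nat.succ_le_of_lt (Nat.factorial_pos _)
    nlinarith
  have he : Real.exp 2 = Real.exp 1 ^ 2 := by rw [← Real.exp_nat_mul]; norm_num
  calc ∑ k ∈ S, (freq k ^ m * Real.exp (-r * bilaplacianSymbol k)) ^ 2
      ≤ ∑ k ∈ S, ((2 * m).factorial * Real.exp 2 * (q ^ (2 * m))⁻¹) * Real.exp (-(q * freq k)) :=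
        Finset.sum_le_sum fun k _ => hterm k
    _ = ((2 * m).factorial * Real.exp 2 * (q ^ (2 * m))⁻¹) * ∑ k ∈ S, Real.exp (-(q * freq k)) :=
        by rw [Finset.mul_sum]
    _ ≤ ((2 * m).factorial ^ 2 * Real.exp 2 * (q ^ (2 * m))⁻¹) * (4 / q) ^ 2 := by
        gcongr
        exact sum_exp_freq_le hq hq1 S
    _ = _ := by
        rw [hqm, kernelConst, he]
        field_simp
        ring

end ThinFilm

namespace ThinFilm

open UnitAddTorus Filter Topology
open scoped ComplexConjugate

/-! ### Weak gradients and Fourier coefficients -/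

instance isAddHaarMeasure_volume_unitAddCircle :
    Measure.IsAddHaarMeasure (volume : Measure UnitAddCircle) :=
  inferInstanceAs (Measure.IsAddHaarMeasure AddCircle.haarAddCircle)

theorem isOpenQuotientMap_torus :
    IsOpenQuotientMap (fun (x : Fin 2 → ℝ) (i : Fin 2) => (x i : UnitAddCircle)) :=
  IsOpenQuotientMap.piMap fun _ => QuotientAddGroup.isOpenQuotientMap_mk

theorem torus_add_single (x : Fin 2 → ℝ) (j : Fin 2) (s : ℝ) :
    (fun i => (x i : UnitAddCircle)) + Pi.single j (s : UnitAddCircle) =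
      fun i => ((x + s • Pi.single j (1 : ℝ) : Fin 2 → ℝ) i : UnitAddCircle) := by
  ext i
  rcases eq_or_ne i j with rfl | h
  · simp
  · simp [h]

theorem IsSmooth.continuous {φ : Torus2 → ℝ} (hφ : IsSmooth φ) : Continuous φ :=
  isOpenQuotientMap_torus.isQuotientMap.continuous_iff.2 (ContDiff.continuous hφ)

theorem IsSmooth.hasDerivAt_lift {φ : Torus2 → ℝ} (hφ : IsSmooth φ) (j : Fin 2) (x : Fin 2 → ℝ)
    (s : ℝ) : HasDerivAt
      (fun s : ℝ => φ ((fun i => (x i : UnitAddCircle)) + Pi.single j (s : UnitAddCircle)))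
      (fderiv ℝ (fun x : Fin 2 → ℝ => φ (fun i => (x i : UnitAddCircle)))
        (x + s • Pi.single j (1 : ℝ)) (Pi.single j 1)) s := by
  simp only [torus_add_single]
  have h1 : HasDerivAt (fun s : ℝ => x + s • (Pi.single j (1 : ℝ) : Fin 2 → ℝ))
      (Pi.single j (1 : ℝ)) s := by
    simpa using ((hasDerivAt_id s).smul_const (Pi.single j (1 : ℝ) : Fin 2 → ℝ)).const_add x
  have h2 := ((ContDiff.differentiable hφ (by simp)) (x + s • Pi.single j (1 : ℝ))).hasFDerivAt
  exact h2.comp_hasDerivAt s h1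

theorem IsSmooth.partialDeriv_lift {φ : Torus2 → ℝ} (hφ : IsSmooth φ) (j : Fin 2)
    (x : Fin 2 → ℝ) : partialDeriv j φ (fun i => (x i : UnitAddCircle)) =
      fderiv ℝ (fun x : Fin 2 → ℝ => φ (fun i => (x i : UnitAddCircle))) x (Pi.single j 1) := by
  have := (hφ.hasDerivAt_lift j x 0).deriv
  rw [zero_smul, add_zero] at this
  exact this

theorem IsSmooth.continuous_partialDeriv {φ : Torus2 → ℝ} (hφ : IsSmooth φ) (j : Fin 2) :
    Continuous (partialDeriv j φ) := by
  refine isOpenQuotientMap_torus.isQuotientMap.continuous_iff.2 ?_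
  have : Continuous fun x => fderiv ℝ (fun x : Fin 2 → ℝ => φ (fun i => (x i : UnitAddCircle))) x
      (Pi.single j 1) := (ContDiff.continuous_fderiv hφ (by simp)).clm_apply continuous_const
  exact this.congr fun x => (hφ.partialDeriv_lift j x).symm

theorem IsSmooth.hasDerivAt {φ : Torus2 → ℝ} (hφ : IsSmooth φ) (j : Fin 2) (y : Torus2) (s : ℝ) :
    HasDerivAt (fun s : ℝ => φ (y + Pi.single j (s : UnitAddCircle)))
      (partialDeriv j φ (y + Pi.single j (s : UnitAddCircle))) s := by
  obtain ⟨x, rfl⟩ := isOpenQuotientMap_torus.surjective y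
  have := hφ.hasDerivAt_lift j x s
  rw [← hφ.partialDeriv_lift, ← torus_add_single] at this
  exact this

theorem mFourier_add_single (k : Fin 2 → ℤ) (y : Torus2) (j : Fin 2) (s : ℝ) :
    mFourier k (y + Pi.single j (s : UnitAddCircle)) =
      mFourier k y * Complex.exp (2 * Real.pi * Complex.I * k j * s) := by
  have h1 : ∀ i, fourier (k i) ((y + Pi.single j (s : UnitAddCircle) : Torus2) i) =
      fourier (k i) (y i) * (if i = j then fourier (k j) (s : UnitAddCircle) else 1) := fun i => by
    rcases eq_or_ne i j with rfl | h
    · simp [fourier_apply, AddCircle.toCircle_add]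
    · simp [h]
  simp only [mFourier, ContinuousMap.coe_mk, h1, Finset.prod_mul_distrib, Finset.prod_ite_eq',
    Finset.mem_univ, if_true, fourier_coe_apply]
  simp

theorem hasDerivAt_mFourier (k : Fin 2 → ℤ) (y : Torus2) (j : Fin 2) (s : ℝ) :
    HasDerivAt (fun s : ℝ => mFourier k (y + Pi.single j (s : UnitAddCircle)))
      (2 * Real.pi * Complex.I * k j * mFourier k (y + Pi.single j (s : UnitAddCircle))) s := by
  simp only [mFourier_add_single]
  have h : HasDerivAt (fun s : ℝ => 2 * Real.pi * Complex.I * k j * (s : ℂ))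
      (2 * Real.pi * Complex.I * k j) s := by
    simpa using (Complex.ofRealCLM.hasDerivAt (x := s)).const_mul (2 * Real.pi * Complex.I * k j)
  refine (h.cexp.const_mul (mFourier k y)).congr_deriv ?_
  ring

/-- By translation invariance the integral of the translates of `ψ` along the `j`-th axis is
constant in `s`; differentiating under the integral at `s = 0` gives the claim. Applied to products,
it is integration by parts on the torus. -/
theorem integral_eq_zero_of_hasDerivAt {ψ ψ' : Torus2 → ℂ} (hψ : Continuous ψ)
    (hψ' : Continuous ψ') (j : Fin 2)
    (h : ∀ (y : Torus2) (s : ℝ), HasDerivAt (fun s : ℝ => ψ (y + Pi.single j (s : UnitAddCircle)))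
      (ψ' (y + Pi.single j (s : UnitAddCircle))) s) : ∫ y, ψ' y = 0 := by
  obtain ⟨C, hC⟩ := isCompact_univ.exists_bound_of_continuousOn hψ'.continuousOn
  have hi : ∀ s : UnitAddCircle, Continuous fun y : Torus2 => ψ (y + Pi.single j s) :=
    fun s => hψ.comp (by fun_prop)
  have hi' : ∀ s : UnitAddCircle, Continuous fun y : Torus2 => ψ' (y + Pi.single j s) :=
    fun s => hψ'.comp (by fun_prop)
  have key := (hasDerivAt_integral_of_dominated_loc_of_deriv_le (μ := (volume : Measure Torus2))
    (F := fun (s : ℝ) y => ψ (y + Pi.single j (s : UnitAddCircle)))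
    (F' := fun (s : ℝ) y => ψ' (y + Pi.single j (s : UnitAddCircle)))
    (x₀ := 0) (s := univ) (bound := fun _ => C) univ_mem
    (Eventually.of_forall fun s => (hi s).aestronglyMeasurable)
    ((hi _).integrable_of_hasCompactSupport (HasCompactSupport.of_compactSpace _))
    (hi' _).aestronglyMeasurable (ae_of_all _ fun y s _ => hC _ (mem_univ _))
    (integrable_const C) (ae_of_all _ fun y s _ => h y s)).2
  have hconst : (fun s : ℝ => ∫ y : Torus2, ψ (y + Pi.single j (s : UnitAddCircle))) =
      fun _ => ∫ y, ψ y := by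
    ext s
    exact integral_add_right_eq_self ψ _
  rw [hconst] at key
  have h0 := key.unique (hasDerivAt_const _ _)
  simpa using h0

theorem integral_mFourier_mul_partialDeriv {φ : Torus2 → ℝ} (hφ : IsSmooth φ) (j : Fin 2)
    (k : Fin 2 → ℤ) : ∫ y, mFourier k y * (partialDeriv j φ y : ℂ) =
      -(2 * Real.pi * Complex.I * k j * ∫ y, mFourier k y * (φ y : ℂ)) := by
  have hc1 : Continuous fun y => mFourier k y * (partialDeriv j φ y : ℂ) :=
    (mFourier k).continuous.mul (Complex.continuous_ofReal.comp (hφ.continuous_partialDeriv j))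
  have hc2 : Continuous fun y => mFourier k y * (φ y : ℂ) :=
    (mFourier k).continuous.mul (Complex.continuous_ofReal.comp hφ.continuous)
  have h := integral_eq_zero_of_hasDerivAt
    (ψ := fun y => mFourier k y * (φ y : ℂ))
    (ψ' := fun y => 2 * Real.pi * Complex.I * k j * (mFourier k y * (φ y : ℂ)) +
      mFourier k y * (partialDeriv j φ y : ℂ)) hc2 ((continuous_const.mul hc2).add hc1) j
    (fun y s => by
      refine ((hasDerivAt_mFourier k y j s).mul (hφ.hasDerivAt j y s).ofReal_comp).congr_deriv ?_
      ring)
  have hint : ∀ {f : Torus2 → ℂ}, Continuous f → Integrable f := fun hf =>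
    hf.integrable_of_hasCompactSupport (HasCompactSupport.of_compactSpace _)
  rw [integral_add ((hint hc2).const_mul _) (hint hc1), integral_const_mul] at h
  linear_combination h

theorem contDiff_mFourier_lift (k : Fin 2 → ℤ) :
    ContDiff ℝ ∞ fun x : Fin 2 → ℝ => mFourier k (fun i => (x i : UnitAddCircle)) := by
  simp only [mFourier, ContinuousMap.coe_mk, fourier_coe_apply]
  refine contDiff_prod fun i _ => ?_
  refine ContDiff.cexp ?_
  refine ContDiff.div_const (contDiff_const.mul ?_) _
  exact Complex.ofRealCLM.contDiff.comp (contDiff_apply ℝ ℝ i)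

/-- Real linear functionals of an exponential monomial are smooth. -/
theorem isSmooth_clm_mFourier (A : ℂ →L[ℝ] ℝ) (k : Fin 2 → ℤ) :
    IsSmooth fun x => A (mFourier k x) :=
  A.contDiff.comp (contDiff_mFourier_lift k)

theorem partialDeriv_clm_mFourier (A : ℂ →L[ℝ] ℝ) (k : Fin 2 → ℤ) (j : Fin 2) (y : Torus2) :
    partialDeriv j (fun x => A (mFourier k x)) y =
      A (2 * Real.pi * Complex.I * k j * mFourier k y) := by
  have := (A.hasFDerivAt.comp_hasDerivAt (0 : ℝ) (hasDerivAt_mFourier k y j 0)).deriv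
  rw [AddCircle.coe_zero, Pi.single_zero, add_zero] at this
  exact this

theorem HasWeakGradient.integrable_apply {f : Torus2 → ℝ} {g : Torus2 → Plane}
    (h : HasWeakGradient f g) (j : Fin 2) : Integrable fun x => g x j :=
  (EuclideanSpace.proj j : Plane →L[ℝ] ℝ).integrable_comp h.integrable_grad

theorem integral_clm_mul {f : Torus2 → ℝ} (hf : Integrable f) (A : ℂ →L[ℝ] ℝ) (c : ℂ)
    (k : Fin 2 → ℤ) :
    ∫ y, f y * A (c * mFourier k y) = A (c * ∫ y, mFourier k y * (f y : ℂ)) := by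
  rw [← integral_const_mul, ← A.integral_comp_comm]
  · congr 1
    ext y
    rw [← smul_eq_mul, ← A.map_smul]
    congr 1
    rw [Complex.real_smul]
    ring
  · exact (integrable_mFourier_mul (integrable_complex_ofReal hf) _).const_mul _

/-- The test functions are the real and imaginary parts of exponentials. In particular a function
has at most one weak gradient, whatever integrability it is presented with. -/
theorem HasWeakGradient.coeff_eq {f : Torus2 → ℝ} {g : Torus2 → Plane} (h : HasWeakGradient f g)
    (j : Fin 2) (k : Fin 2 → ℤ) :
    coeff (fun x => g x j) k = 2 * Real.pi * Complex.I * k j * coeff f k := by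
  have key : ∀ A : ℂ →L[ℝ] ℝ, A (coeff (fun x => g x j) k) =
      A (2 * Real.pi * Complex.I * k j * coeff f k) := fun A => by
    have h1 := h.integral_eq _ (isSmooth_clm_mFourier A (-k)) j
    simp only [partialDeriv_clm_mFourier] at h1
    rw [integral_clm_mul h.integrable_fun] at h1
    have h2 := integral_clm_mul (h.integrable_apply j) A 1 (-k)
    simp only [one_mul] at h2
    rw [h2] at h1
    rw [coeff_def, coeff_def, ← neg_eq_iff_eq_neg.2 h1, ← map_neg]
    congr 1
    push_cast [Pi.neg_apply]
    ring
  exact Complex.ext (key Complex.reCLM) (key Complex.imCLM)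

/-! ### Gradient bounds in `L²` read off from finitely many frequencies at a time. -/

/-- The truncated sequence `(2π|k| ẑ(k))_{k ∈ S}`. -/
noncomputable def truncGrad (S : Finset (Fin 2 → ℤ)) : L2 →L[ℝ] EuclideanSpace ℂ S :=
  ((EuclideanSpace.equiv S ℂ).symm.toContinuousLinearMap.restrictScalars ℝ).comp
    (ContinuousLinearMap.pi fun k : S => (freq k) • coeffCLM k)

theorem norm_truncGrad_sq (S : Finset (Fin 2 → ℤ)) (z : L2) :
    ‖truncGrad S z‖ ^ 2 = ∑ k ∈ S, (freq k * ‖coeff z k‖) ^ 2 := by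
  rw [EuclideanSpace.norm_sq_eq, ← Finset.sum_coe_sort S]
  refine Finset.sum_congr rfl fun k _ => ?_
  congr 1
  change ‖freq k • coeffCLM k z‖ = _
  rw [norm_smul, Real.norm_of_nonneg (freq_nonneg _), coeffCLM_apply]

/-- `‖∇z‖_{L²} ≤ K`, expressed by the Fourier coefficients of `z`. -/
def GradBound (z : L2) (K : ℝ) : Prop := ∀ S, ‖truncGrad S z‖ ≤ K

theorem GradBound.nonneg {z : L2} {K : ℝ} (h : GradBound z K) : 0 ≤ K :=
  (norm_nonneg _).trans (h ∅)

theorem GradBound.add {z z' : L2} {K K' : ℝ} (h : GradBound z K) (h' : GradBound z' K') :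
    GradBound (z + z') (K + K') := fun S => by
  rw [map_add]
  exact (norm_add_le _ _).trans (add_le_add (h S) (h' S))

theorem GradBound.mono {z : L2} {K K' : ℝ} (h : GradBound z K) (hK : K ≤ K') : GradBound z K' :=
  fun S => (h S).trans hK

theorem gradBound_iff {z : L2} {K : ℝ} (hK : 0 ≤ K) :
    GradBound z K ↔ ∀ S : Finset (Fin 2 → ℤ), ∑ k ∈ S, (freq k * ‖coeff z k‖) ^ 2 ≤ K ^ 2 := by
  refine forall_congr' fun S => ?_
  rw [← norm_truncGrad_sq, pow_le_pow_iff_left₀ (norm_nonneg _) hK two_ne_zero]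

/-- The symbol of `∂ⱼ` applied to the Fourier coefficients of `z`. -/
noncomputable def gradCoeff (j : Fin 2) (z : L2) (k : Fin 2 → ℤ) : ℂ :=
  2 * Real.pi * Complex.I * k j * coeff z k

theorem norm_two_pi_I_mul_le (j : Fin 2) (k : Fin 2 → ℤ) :
    ‖(2 * Real.pi * Complex.I * k j : ℂ)‖ ≤ freq k := by
  refine le_trans (le_of_eq ?_) (two_pi_abs_le_freq k j)
  simp [abs_of_pos Real.pi_pos]

theorem norm_gradCoeff_le (j : Fin 2) (z : L2) (k : Fin 2 → ℤ) :
    ‖gradCoeff j z k‖ ≤ freq k * ‖coeff z k‖ := by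
  rw [gradCoeff, norm_mul]
  gcongr
  exact norm_two_pi_I_mul_le j k

theorem GradBound.sum_gradCoeff_le {z : L2} {K : ℝ} (h : GradBound z K) (j : Fin 2)
    (S : Finset (Fin 2 → ℤ)) : ∑ k ∈ S, ‖gradCoeff j z k‖ ^ 2 ≤ K ^ 2 := by
  refine le_trans (Finset.sum_le_sum fun k _ => ?_) ((gradBound_iff h.nonneg).1 h S)
  gcongr
  exact norm_gradCoeff_le j z k

/-- The embedding of the `j`-th coordinate axis into the plane, on the level of `L²`. -/
noncomputable def axisCLM (j : Fin 2) : L2 →L[ℝ] L2Vec :=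
  (ContinuousLinearMap.toSpanSingleton ℝ (EuclideanSpace.single j (1 : ℝ) : Plane)).compLpL 2 volume

theorem norm_axisCLM_le (j : Fin 2) (f : L2) : ‖axisCLM j f‖ ≤ ‖f‖ := by
  refine (ContinuousLinearMap.norm_compLp_le _ _).trans ?_
  rw [ContinuousLinearMap.norm_toSpanSingleton]
  simp

/-- The gradient of `z`, defined by its Fourier coefficients. -/
noncomputable def gradOf (z : L2) : L2Vec := ∑ j, axisCLM j (invFourier (gradCoeff j z))

theorem gradOf_apply (z : L2) (j : Fin 2) :
    (fun x => gradOf z x j) =ᵐ[volume] invFourier (gradCoeff j z) := by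
  have h : ∀ j, (axisCLM j (invFourier (gradCoeff j z)) : L2Vec) =ᵐ[volume]
      fun x => invFourier (gradCoeff j z) x • (EuclideanSpace.single j (1 : ℝ) : Plane) :=
    fun j => ContinuousLinearMap.coeFn_compLpL (p := 2) _ _
  have hg : gradOf z = axisCLM 0 (invFourier (gradCoeff 0 z)) +
      axisCLM 1 (invFourier (gradCoeff 1 z)) := Fin.sum_univ_two _
  rw [hg]
  filter_upwards [h 0, h 1, Lp.coeFn_add (axisCLM 0 (invFourier (gradCoeff 0 z)))
    (axisCLM 1 (invFourier (gradCoeff 1 z)))] with x h0 h1 h2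
  rw [h2, Pi.add_apply, h0, h1]
  fin_cases j <;> simp

/-- Each of the two components is bounded by `K`. The factor `2` from the triangle inequality is not
sharp and is absorbed in the contraction constants. -/
theorem GradBound.norm_gradOf_le {z : L2} {K : ℝ} (h : GradBound z K) : ‖gradOf z‖ ≤ 2 * K := by
  refine (norm_sum_le _ _).trans ?_
  refine (Finset.sum_le_sum fun j _ => (norm_axisCLM_le j _).trans
    (norm_invFourier_le h.nonneg (h.sum_gradCoeff_le j))).trans_eq ?_
  simp

theorem hasSum_integral_invFourier {c : (Fin 2 → ℤ) → ℂ} (hc : Summable fun k => ‖c k‖ ^ 2)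
    {h : Torus2 → ℝ} (hh : Continuous h) :
    HasSum (fun k => (c k * ∫ y, mFourier k y * (h y : ℂ)).re) (∫ y, invFourier c y * h y) := by
  have hL : MemLp h 2 (volume : Measure Torus2) := by
    obtain ⟨C, hC⟩ := isCompact_univ.exists_bound_of_continuousOn hh.continuousOn
    exact MemLp.of_bound hh.aestronglyMeasurable C (ae_of_all _ fun x => hC x (mem_univ x))
  have hi : Integrable h := hL.integrable one_le_two
  have hin : ∀ f : L2, innerSL ℝ (hL.toLp h) f = ∫ y, f y * h y := fun f => by
    rw [innerSL_apply_apply, L2.inner_def]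
    refine integral_congr_ae ?_
    filter_upwards [hL.coeFn_toLp] with y hy
    rw [hy]
    simp
  have := (hasSum_invFourier hc).mapL (innerSL ℝ (hL.toLp h))
  rw [hin] at this
  refine this.congr_fun fun k => ?_
  rw [hin, ← Complex.reCLM_apply, ← integral_clm_mul hi]
  refine integral_congr_ae ?_
  filter_upwards [Complex.reCLM.coeFn_compLpL (p := 2) (c k • mFourierLp (d := Fin 2) 2 k),
    Lp.coeFn_smul (c k) (mFourierLp (d := Fin 2) 2 k), coeFn_mFourierLp (d := Fin 2) 2 k]
    with y h1 h2 h3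
  rw [h1, h2, Pi.smul_apply, h3, smul_eq_mul, mul_comm]

theorem integrable_L2 (f : L2) : Integrable f := (Lp.memLp f).integrable one_le_two

theorem integrable_L2Vec (f : L2Vec) : Integrable f := (Lp.memLp f).integrable one_le_two

/-- Both sides of the weak identity expand into Fourier series paired with a continuous function,
and they agree term by term after integrating by parts against each exponential. -/
theorem GradBound.hasWeakGradient {z : L2} {K : ℝ} (h : GradBound z K) :
    HasWeakGradient z (gradOf z) where
  integrable_fun := integrable_L2 z
  integrable_grad := integrable_L2Vec _
  integral_eq φ hφ j := by
    have h1 := hasSum_integral_invFourier (summable_coeff z) (hφ.continuous_partialDeriv j)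
    have h2 := (hasSum_integral_invFourier (summable_of_sum_le (h.sum_gradCoeff_le j))
      hφ.continuous).neg
    rw [invFourier_coeff] at h1
    have h3 : ∫ y, gradOf z y j * φ y = ∫ y, invFourier (gradCoeff j z) y * φ y := by
      refine integral_congr_ae ?_
      filter_upwards [gradOf_apply z j] with y hy
      rw [hy]
    rw [h3]
    refine h1.unique (h2.congr_fun fun k => ?_)
    rw [integral_mFourier_mul_partialDeriv hφ, ← Complex.neg_re, gradCoeff]
    congr 1
    ring

/-- Integrable vector fields with the same Fourier coefficients agree. -/
theorem vectorField_ae_eq_of_coeff {g g' : Torus2 → Plane} (hg : Integrable g)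
    (hg' : Integrable g') (h : ∀ j k, coeff (fun x => g x j) k = coeff (fun x => g' x j) k) :
    g =ᵐ[volume] g' := by
  have : ∀ j, (fun x => g x j) =ᵐ[volume] fun x => g' x j := fun j =>
    ThinFilm.ae_eq_of_coeff ((EuclideanSpace.proj j : Plane →L[ℝ] ℝ).integrable_comp hg)
      ((EuclideanSpace.proj j : Plane →L[ℝ] ℝ).integrable_comp hg') (h j)
  filter_upwards [this 0, this 1] with x h0 h1
  ext j
  fin_cases j
  · exact h0
  · exact h1

end ThinFilm

namespace ThinFilm

open UnitAddTorus Filter Topology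
open scoped ComplexConjugate

/-! ### The semigroup acting on families of Fourier coefficients -/

/-- `e^{-rℒ}` applied to the (possibly distributional) Fourier coefficients `N`. -/
noncomputable def heat (r : ℝ) (N : (Fin 2 → ℤ) → ℂ) : L2 :=
  invFourier fun k => (Real.exp (-r * bilaplacianSymbol k) : ℂ) * N k

theorem semigroup_eq_heat (r : ℝ) (f : Torus2 → ℝ) : semigroup r f = heat r (coeff f) := rfl

section Heat

variable {m : ℕ} {D r : ℝ} {N N' : (Fin 2 → ℤ) → ℂ}

theorem norm_ofReal_exp (x : ℝ) : ‖(Real.exp x : ℂ)‖ = Real.exp x := by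
  rw [Complex.norm_real, Real.norm_of_nonneg (Real.exp_pos _).le]

/-- Here `m` counts the derivatives already carried by the source and `n` those taken of the output;
the kernel only sees their sum. -/
theorem sum_freq_heat_le (n : ℕ) (hr : 0 < r) (hr1 : r ≤ 1)
    (hN : ∀ k, ‖N k‖ ≤ D * freq k ^ m) (S : Finset (Fin 2 → ℤ)) :
    ∑ k ∈ S, (freq k ^ n * ‖(Real.exp (-r * bilaplacianSymbol k) : ℂ) * N k‖) ^ 2 ≤
      (D * (kernelConst (n + m) * r ^ (-(((n + m : ℕ) + 1 : ℝ) / 4)))) ^ 2 := by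
  calc _ ≤ ∑ k ∈ S, D ^ 2 * (freq k ^ (n + m) * Real.exp (-r * bilaplacianSymbol k)) ^ 2 := by
        gcongr with k
        rw [norm_mul, norm_ofReal_exp, ← mul_pow]
        have := freq_nonneg k
        refine pow_le_pow_left₀ (by positivity) ?_ 2
        calc _ ≤ freq k ^ n * (Real.exp (-r * bilaplacianSymbol k) * (D * freq k ^ m)) := by
              gcongr; exact hN k
          _ = _ := by ring
    _ ≤ _ := by
        rw [← Finset.mul_sum, mul_pow D]
        gcongr
        exact sum_kernel_le _ hr hr1 S

theorem sum_heat_le (hr : 0 < r) (hr1 : r ≤ 1)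
    (hN : ∀ k, ‖N k‖ ≤ D * freq k ^ m) (S : Finset (Fin 2 → ℤ)) :
    ∑ k ∈ S, ‖(Real.exp (-r * bilaplacianSymbol k) : ℂ) * N k‖ ^ 2 ≤
      (D * (kernelConst m * r ^ (-((m + 1 : ℝ) / 4)))) ^ 2 := by
  simpa using sum_freq_heat_le 0 hr hr1 hN S

theorem summable_heat (hr : 0 < r) (hr1 : r ≤ 1)
    (hN : ∀ k, ‖N k‖ ≤ D * freq k ^ m) :
    Summable fun k => ‖(Real.exp (-r * bilaplacianSymbol k) : ℂ) * N k‖ ^ 2 :=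
  summable_of_sum_le (sum_heat_le hr hr1 hN)

theorem norm_heat_le (hr : 0 < r) (hr1 : r ≤ 1) (hD : 0 ≤ D)
    (hN : ∀ k, ‖N k‖ ≤ D * freq k ^ m) :
    ‖heat r N‖ ≤ D * (kernelConst m * r ^ (-((m + 1 : ℝ) / 4))) :=
  norm_invFourier_le (mul_nonneg hD (mul_nonneg (kernelConst_pos m).le (Real.rpow_nonneg hr.le _)))
    (sum_heat_le hr hr1 hN)

theorem isHermitianSeq_exp_mul (r : ℝ) (hs : IsHermitianSeq N) :
    IsHermitianSeq fun k => (Real.exp (-r * bilaplacianSymbol k) : ℂ) * N k := fun k => by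
  have : bilaplacianSymbol (-k) = bilaplacianSymbol k := by simp [bilaplacianSymbol]
  simp only [this, hs k, map_mul, Complex.conj_ofReal]

theorem coeff_heat (hr : 0 < r) (hr1 : r ≤ 1)
    (hN : ∀ k, ‖N k‖ ≤ D * freq k ^ m) (hs : IsHermitianSeq N) (k : Fin 2 → ℤ) :
    coeff (heat r N) k = (Real.exp (-r * bilaplacianSymbol k) : ℂ) * N k :=
  coeff_invFourier (summable_heat hr hr1 hN) (isHermitianSeq_exp_mul r hs) k

theorem gradBound_heat (hr : 0 < r) (hr1 : r ≤ 1) (hD : 0 ≤ D)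
    (hN : ∀ k, ‖N k‖ ≤ D * freq k ^ m) (hs : IsHermitianSeq N) :
    GradBound (heat r N) (D * (kernelConst (m + 1) * r ^ (-((m + 2 : ℝ) / 4)))) := by
  rw [gradBound_iff
    (mul_nonneg hD (mul_nonneg (kernelConst_pos _).le (Real.rpow_nonneg hr.le _)))]
  intro S
  have := sum_freq_heat_le 1 hr hr1 hN S
  simp only [coeff_heat hr hr1 hN hs]
  convert this using 4
  · simp
  · rw [add_comm]
  · push_cast; ring_nf

theorem heat_sub {D' : ℝ} (hr : 0 < r) (hr1 : r ≤ 1)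
    (hN : ∀ k, ‖N k‖ ≤ D * freq k ^ m) (hN' : ∀ k, ‖N' k‖ ≤ D' * freq k ^ m) :
    heat r N - heat r N' = heat r fun k => N k - N' k := by
  rw [heat, heat, ← invFourier_sub (summable_heat hr hr1 hN) (summable_heat hr hr1 hN'),
    heat]
  simp only [mul_sub]

theorem IsHermitianSeq.sub (h : IsHermitianSeq N) (h' : IsHermitianSeq N') :
    IsHermitianSeq fun k => N k - N' k := fun k => by
  simp only [h k, h' k, map_sub]

end Heat

/-! ### Hölder estimates for the nonlinear terms -/

/-- With `‖y‖ ≤ ‖x‖`, the difference splits into `‖x‖^(p-2) (x - y)` and the variation of the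
modulus times `y`; each part is bounded by `‖x‖^(p-2) ‖x - y‖`. -/
theorem norm_flux_sub_le {p : ℝ} (hp₂ : 2 ≤ p) (hp₃ : p ≤ 3) (x y : Plane) :
    ‖flux p x - flux p y‖ ≤ 2 * (‖x‖ + ‖y‖) ^ (p - 2) * ‖x - y‖ := by
  wlog hxy : ‖y‖ ≤ ‖x‖ generalizing x y
  · rw [norm_sub_rev, norm_sub_rev x, add_comm]
    exact this y x (le_of_not_ge hxy)
  rcases (norm_nonneg x).eq_or_lt' with h0 | hx
  · have hx0 : x = 0 := norm_eq_zero.1 h0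
    have hy0 : y = 0 := norm_eq_zero.1 (le_antisymm (hxy.trans h0.le) (norm_nonneg _))
    simp [hx0, hy0]
  have hq0 : 0 ≤ p - 2 := by linarith
  have hxq : 0 ≤ ‖x‖ ^ (p - 2) := Real.rpow_nonneg hx.le _
  -- Uses `p - 2 ≤ 1`: a number in `[0,1]` is at most its power `p - 2`. This controls the variation
  -- of the modulus without the mean value theorem.
  have h1 : ‖x‖ ^ (p - 2) * (‖y‖ / ‖x‖) ≤ ‖y‖ ^ (p - 2) := by
    calc ‖x‖ ^ (p - 2) * (‖y‖ / ‖x‖) ≤ ‖x‖ ^ (p - 2) * (‖y‖ / ‖x‖) ^ (p - 2) := by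
          gcongr
          exact Real.self_le_rpow_of_le_one (by positivity) ((div_le_one hx).2 hxy) (by linarith)
      _ = ‖y‖ ^ (p - 2) := by
          rw [← Real.mul_rpow hx.le (by positivity), mul_div_cancel₀ _ hx.ne']
  have h2 : ‖y‖ ^ (p - 2) ≤ ‖x‖ ^ (p - 2) := Real.rpow_le_rpow (norm_nonneg _) hxy hq0
  have h3 : (‖x‖ ^ (p - 2) - ‖y‖ ^ (p - 2)) * ‖y‖ ≤ ‖x‖ ^ (p - 2) * ‖x - y‖ := by
    have h4 : ‖x‖ - ‖y‖ ≤ ‖x - y‖ := norm_sub_norm_le x y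
    calc _ ≤ (‖x‖ ^ (p - 2) - ‖x‖ ^ (p - 2) * (‖y‖ / ‖x‖)) * ‖y‖ := by gcongr
      _ = ‖x‖ ^ (p - 2) * ((‖y‖ / ‖x‖) * (‖x‖ - ‖y‖)) := by field_simp
      _ ≤ ‖x‖ ^ (p - 2) * (1 * ‖x - y‖) := by
          have : ‖y‖ / ‖x‖ ≤ 1 := (div_le_one hx).2 hxy
          have : 0 ≤ ‖x‖ - ‖y‖ := sub_nonneg.2 hxy
          gcongr
      _ = _ := by rw [one_mul]
  have h5 : flux p x - flux p y =
      ‖x‖ ^ (p - 2) • (x - y) + (‖x‖ ^ (p - 2) - ‖y‖ ^ (p - 2)) • y := by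
    simp only [flux, smul_sub, sub_smul]
    abel
  have h6 : ‖x‖ ^ (p - 2) ≤ (‖x‖ + ‖y‖) ^ (p - 2) :=
    Real.rpow_le_rpow hx.le (le_add_of_nonneg_right (norm_nonneg _)) hq0
  calc ‖flux p x - flux p y‖ ≤ ‖x‖ ^ (p - 2) * ‖x - y‖ +
        (‖x‖ ^ (p - 2) - ‖y‖ ^ (p - 2)) * ‖y‖ := by
        rw [h5]
        refine (norm_add_le _ _).trans_eq ?_
        rw [norm_smul, norm_smul, Real.norm_of_nonneg hxq,
          Real.norm_of_nonneg (sub_nonneg.2 h2)]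
    _ ≤ 2 * ‖x‖ ^ (p - 2) * ‖x - y‖ := by linarith
    _ ≤ _ := by gcongr

theorem flux_zero (p : ℝ) : flux p 0 = 0 := by simp [flux]

theorem continuous_flux {p : ℝ} (hp₂ : 2 ≤ p) : Continuous (flux p) :=
  (continuous_norm.rpow_const fun _ => Or.inr (by linarith)).smul continuous_id

/-! ### Integral bounds for the flux and the transport term. -/

/-- The pointwise norm of a vector field, as an element of `L²`. -/
noncomputable def normL2 (G : L2Vec) : L2 := (Lp.memLp G).norm.toLp

theorem coeFn_normL2 (G : L2Vec) : normL2 G =ᵐ[volume] fun x => ‖G x‖ := MemLp.coeFn_toLp _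

theorem norm_normL2 (G : L2Vec) : ‖normL2 G‖ = ‖G‖ := by
  rw [normL2, Lp.norm_toLp, eLpNorm_norm, Lp.norm_def]

theorem integrable_norm_mul_norm (G H : L2Vec) : Integrable fun x => ‖G x‖ * ‖H x‖ :=
  (Lp.memLp G).norm.integrable_mul (Lp.memLp H).norm

theorem integral_norm_mul_norm_le (G H : L2Vec) : ∫ x, ‖G x‖ * ‖H x‖ ≤ ‖G‖ * ‖H‖ := by
  have h := real_inner_le_norm (normL2 G) (normL2 H)
  rw [norm_normL2, norm_normL2, L2.inner_def] at h
  refine (integral_congr_ae ?_).trans_le h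
  filter_upwards [coeFn_normL2 G, coeFn_normL2 H] with x h1 h2
  rw [h1, h2]
  simp [mul_comm]

theorem integral_norm_le (G : L2Vec) : ∫ x, ‖G x‖ ≤ ‖G‖ := by
  have h1 : MemLp (fun _ : Torus2 => (EuclideanSpace.single 0 1 : Plane)) 2 volume :=
    memLp_const _
  have h := integral_norm_mul_norm_le G h1.toLp
  have h2 : ‖h1.toLp‖ = 1 := by
    rw [Lp.norm_toLp, eLpNorm_const _ two_ne_zero (NeZero.ne _)]
    simp
  rw [h2, mul_one] at h
  refine (integral_congr_ae ?_).trans_le h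
  filter_upwards [h1.coeFn_toLp] with x hx
  rw [hx]
  simp

theorem integrable_inner (V G : L2Vec) : Integrable fun x => inner ℝ (V x) (G x) := by
  refine (integrable_norm_mul_norm V G).mono'
    ((Lp.aestronglyMeasurable V).inner (Lp.aestronglyMeasurable G))
    (ae_of_all _ fun x => norm_inner_le_norm _ _)

theorem integral_norm_inner_le (V G : L2Vec) : ∫ x, ‖inner ℝ (V x) (G x)‖ ≤ ‖V‖ * ‖G‖ :=
  (integral_mono (integrable_inner V G).norm (integrable_norm_mul_norm V G)
    fun _ => norm_inner_le_norm _ _).trans (integral_norm_mul_norm_le V G)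

/-- Replaces a fractional power by an affine function at scale `A`. When `A` dominates the `L²`
norms involved, Cauchy–Schwarz then does the work of Hölder's inequality with exponents depending on
`p`, with the correct homogeneity in `A`. -/
theorem rpow_le_mul_one_add {q A y : ℝ} (hq0 : 0 ≤ q) (hq1 : q ≤ 1) (hA : 0 < A) (hy : 0 ≤ y) :
    y ^ q ≤ A ^ q * (1 + y / A) := by
  have h1 : (y / A) ^ q ≤ 1 + y / A := by
    rcases le_total (y / A) 1 with h | h
    · exact (Real.rpow_le_one (by positivity) h hq0).trans (by linarith [div_nonneg hy hA.le])
    · refine (Real.rpow_le_rpow_of_exponent_le h hq1).trans ?_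
      rw [Real.rpow_one]
      linarith
  calc y ^ q = A ^ q * (y / A) ^ q := by
        rw [← Real.mul_rpow hA.le (by positivity), mul_div_cancel₀ _ hA.ne']
    _ ≤ _ := by gcongr

section FluxL1

variable {p A : ℝ} {G H : L2Vec}

theorem integrable_flux (hp₂ : 2 ≤ p) (hp₃ : p ≤ 3) (G : L2Vec) :
    Integrable fun x => flux p (G x) := by
  have hb : Integrable fun x => 2 * (‖G x‖ + ‖G x‖ * ‖G x‖) :=
    ((integrable_L2Vec G).norm.add (integrable_norm_mul_norm G G)).const_mul 2
  refine hb.mono' ((continuous_flux hp₂).comp_aestronglyMeasurable (Lp.aestronglyMeasurable G))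
    (ae_of_all _ fun x => ?_)
  have h1 := norm_flux_sub_le hp₂ hp₃ (G x) 0
  rw [flux_zero, sub_zero, norm_zero, add_zero, sub_zero] at h1
  have h2 := rpow_le_mul_one_add (q := p - 2) (by linarith) (by linarith) one_pos (norm_nonneg (G x))
  rw [Real.one_rpow, div_one, one_mul] at h2
  refine h1.trans ?_
  nlinarith [norm_nonneg (G x)]

theorem integral_norm_flux_sub_le (hp₂ : 2 ≤ p) (hp₃ : p ≤ 3) (hA : 0 < A)
    (hGH : ‖G‖ + ‖H‖ ≤ A) :
    ∫ x, ‖flux p (G x) - flux p (H x)‖ ≤ 4 * A ^ (p - 2) * ‖G - H‖ := by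
  have hAq : 0 ≤ A ^ (p - 2) := Real.rpow_nonneg hA.le _
  have hi1 := (integrable_L2Vec (G - H)).norm
  have hi2 := (integrable_norm_mul_norm G (G - H))
  have hi3 := (integrable_norm_mul_norm H (G - H))
  have hi4 : Integrable fun x => A⁻¹ * (‖G x‖ * ‖(G - H) x‖ + ‖H x‖ * ‖(G - H) x‖) :=
    (hi2.add hi3).const_mul _
  calc ∫ x, ‖flux p (G x) - flux p (H x)‖
      ≤ ∫ x, 2 * A ^ (p - 2) * (‖(G - H) x‖ + A⁻¹ * (‖G x‖ * ‖(G - H) x‖ +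
          ‖H x‖ * ‖(G - H) x‖)) := by
        refine integral_mono_ae ((integrable_flux hp₂ hp₃ G).sub (integrable_flux hp₂ hp₃ H)).norm
          ((hi1.add hi4).const_mul _) ?_
        filter_upwards [Lp.coeFn_sub G H] with x hx
        refine (norm_flux_sub_le hp₂ hp₃ _ _).trans ?_
        have h2 := rpow_le_mul_one_add (q := p - 2) (by linarith) (by linarith) hA
          (add_nonneg (norm_nonneg (G x)) (norm_nonneg (H x)))
        simp only [hx, Pi.sub_apply]
        calc _ ≤ 2 * (A ^ (p - 2) * (1 + (‖G x‖ + ‖H x‖) / A)) * ‖G x - H x‖ := by gcongr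
          _ = _ := by field_simp
    _ = 2 * A ^ (p - 2) * ((∫ x, ‖(G - H) x‖) + A⁻¹ * ((∫ x, ‖G x‖ * ‖(G - H) x‖) +
          ∫ x, ‖H x‖ * ‖(G - H) x‖)) := by
        rw [integral_const_mul, integral_add hi1 hi4, integral_const_mul,
          integral_add hi2 hi3]
    _ ≤ 2 * A ^ (p - 2) * (‖G - H‖ + A⁻¹ * (‖G‖ * ‖G - H‖ + ‖H‖ * ‖G - H‖)) := by
        gcongr
        · exact integral_norm_le _
        · exact integral_norm_mul_norm_le _ _
        · exact integral_norm_mul_norm_le _ _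
    _ = 2 * A ^ (p - 2) * ((1 + A⁻¹ * (‖G‖ + ‖H‖)) * ‖G - H‖) := by ring
    _ ≤ 2 * A ^ (p - 2) * ((1 + A⁻¹ * A) * ‖G - H‖) := by gcongr
    _ = _ := by
        rw [inv_mul_cancel₀ hA.ne']
        ring

/-- The Fourier coefficients of `∇ · (|G|^{p-2} G)`. -/
noncomputable def fluxSource (p : ℝ) (G : L2Vec) (k : Fin 2 → ℤ) : ℂ :=
  ∑ j : Fin 2, 2 * Real.pi * Complex.I * k j * coeff (fun x => flux p (G x) j) k

/-- The Fourier coefficients of `V · G`. -/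
noncomputable def transportSource (V G : L2Vec) (k : Fin 2 → ℤ) : ℂ :=
  coeff (fun x => inner ℝ (V x) (G x)) k

theorem divSemigroup_eq_heat (r : ℝ) (G : L2Vec) :
    divSemigroup r (fun x => flux p (G x)) = heat r (fluxSource p G) := by
  rw [divSemigroup, heat]
  congr 1
  ext k
  rw [fluxSource, Finset.mul_sum]
  refine Finset.sum_congr rfl fun j _ => ?_
  ring

theorem isHermitianSeq_fluxSource (p : ℝ) (G : L2Vec) : IsHermitianSeq (fluxSource p G) :=
  fun k => by
    simp only [fluxSource, coeff_neg, map_sum, map_mul, Complex.conj_I, Complex.conj_ofReal,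
      map_ofNat, Pi.neg_apply, Int.cast_neg, map_intCast]
    refine Finset.sum_congr rfl fun j _ => ?_
    ring

theorem isHermitianSeq_transportSource (V G : L2Vec) : IsHermitianSeq (transportSource V G) :=
  coeff_neg _

/-- The divergence accounts for the factor `freq k`, and the two components double the constant of
the `L¹` estimate. -/
theorem norm_fluxSource_sub_le (hp₂ : 2 ≤ p) (hp₃ : p ≤ 3) (hA : 0 < A) (hGH : ‖G‖ + ‖H‖ ≤ A)
    (k : Fin 2 → ℤ) :
    ‖fluxSource p G k - fluxSource p H k‖ ≤ 8 * A ^ (p - 2) * ‖G - H‖ * freq k ^ 1 := by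
  have hi : ∀ (G : L2Vec) (j : Fin 2), Integrable fun x => flux p (G x) j := fun G j =>
    (EuclideanSpace.proj j : Plane →L[ℝ] ℝ).integrable_comp (integrable_flux hp₂ hp₃ G)
  have hj : ∀ j : Fin 2,
      ‖(2 * Real.pi * Complex.I * k j : ℂ) * coeff (fun x => flux p (G x) j) k -
        (2 * Real.pi * Complex.I * k j : ℂ) * coeff (fun x => flux p (H x) j) k‖ ≤
      freq k * (4 * A ^ (p - 2) * ‖G - H‖) := fun j => by
    rw [← mul_sub, ← coeff_sub (hi G j) (hi H j), norm_mul]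
    have := freq_nonneg k
    refine mul_le_mul (norm_two_pi_I_mul_le j k) ?_ (norm_nonneg _) this
    refine (norm_coeff_le _ _).trans (le_trans ?_ (integral_norm_flux_sub_le hp₂ hp₃ hA hGH))
    refine integral_mono ((hi G j).sub (hi H j)).norm
      ((integrable_flux hp₂ hp₃ G).sub (integrable_flux hp₂ hp₃ H)).norm fun x => ?_
    exact PiLp.norm_apply_le (flux p (G x) - flux p (H x)) j
  rw [fluxSource, fluxSource, ← Finset.sum_sub_distrib]
  refine (norm_sum_le _ _).trans ((Finset.sum_le_sum fun j _ => hj j).trans_eq ?_)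
  simp only [Finset.sum_const, Finset.card_univ, Fintype.card_fin, nsmul_eq_mul]
  push_cast
  ring

theorem fluxSource_zero (p : ℝ) : fluxSource p 0 = 0 := by
  ext k
  have h : ∀ j : Fin 2, coeff (fun x => flux p ((0 : L2Vec) x) j) k = 0 := fun j => by
    have : (fun x => flux p ((0 : L2Vec) x) j) =ᵐ[volume] fun _ => (0 : ℝ) := by
      filter_upwards [Lp.coeFn_zero Plane 2 (volume : Measure Torus2)] with x hx
      rw [hx, Pi.zero_apply, flux_zero]
      rfl
    rw [coeff_congr this, coeff_def]
    simp
  simp only [fluxSource, h, mul_zero, Finset.sum_const_zero, Pi.zero_apply]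

theorem transportSource_sub (V G H : L2Vec) (k : Fin 2 → ℤ) :
    transportSource V G k - transportSource V H k = transportSource V (G - H) k := by
  rw [transportSource, transportSource, ← coeff_sub (integrable_inner V G) (integrable_inner V H)]
  refine coeff_congr ?_ k
  filter_upwards [Lp.coeFn_sub G H] with x hx
  rw [hx, Pi.sub_apply, inner_sub_right]

theorem norm_transportSource_le (V G : L2Vec) (k : Fin 2 → ℤ) :
    ‖transportSource V G k‖ ≤ ‖V‖ * ‖G‖ * freq k ^ 0 := by
  rw [pow_zero, mul_one]
  exact (norm_coeff_le _ _).trans (integral_norm_inner_le V G)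

theorem transportSource_zero (V : L2Vec) : transportSource V 0 = 0 := by
  ext k
  have := norm_transportSource_le V 0 k
  rw [norm_zero, mul_zero, zero_mul] at this
  exact norm_le_zero_iff.1 this

theorem norm_fluxSource_le (hp₂ : 2 ≤ p) (hp₃ : p ≤ 3) (hA : 0 < A) (hG : ‖G‖ ≤ A)
    (k : Fin 2 → ℤ) : ‖fluxSource p G k‖ ≤ 8 * A ^ (p - 2) * ‖G‖ * freq k ^ 1 := by
  have := norm_fluxSource_sub_le (H := 0) hp₂ hp₃ hA (by simpa using hG) k
  simpa [fluxSource_zero] using this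

end FluxL1

end ThinFilm

namespace ThinFilm

open UnitAddTorus Filter Topology

/-! ### Singular kernels in time -/

/-- The constant in the bound of the Beta integral. -/
noncomputable def betaConst (a b : ℝ) : ℝ := 2 ^ a / (1 - b) + 2 ^ b / (1 - a)

section Beta

variable {a b t : ℝ}

theorem intervalIntegrable_rpow_neg (hb : b < 1) : IntervalIntegrable (fun s : ℝ => s ^ (-b))
    volume 0 t := intervalIntegral.intervalIntegrable_rpow' (by linarith)

theorem intervalIntegrable_sub_rpow_neg (ha : a < 1) :
    IntervalIntegrable (fun s : ℝ => (t - s) ^ (-a)) volume 0 t := by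
  have := (intervalIntegrable_rpow_neg (t := t) ha).comp_sub_left t
  simpa using this.symm

theorem integral_rpow_neg (hb : b < 1) : ∫ s in (0 : ℝ)..t, s ^ (-b) = t ^ (1 - b) / (1 - b) := by
  rw [integral_rpow (Or.inl (by linarith)), Real.zero_rpow (by linarith), sub_zero]
  ring_nf

theorem integral_sub_rpow_neg (ha : a < 1) :
    ∫ s in (0 : ℝ)..t, (t - s) ^ (-a) = t ^ (1 - a) / (1 - a) := by
  rw [intervalIntegral.integral_comp_sub_left (fun s : ℝ => s ^ (-a)) t, sub_self, sub_zero,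
    integral_rpow_neg ha]

/-- One of `s` and `t - s` is at least `t / 2`, so one of the two singular factors is at most its
value there. -/
theorem rpow_mul_rpow_le (ha : 0 ≤ a) (hb : 0 ≤ b) {s : ℝ} (hs : s ∈ Ioo 0 t) :
    (t - s) ^ (-a) * s ^ (-b) ≤ (t / 2) ^ (-a) * s ^ (-b) + (t / 2) ^ (-b) * (t - s) ^ (-a) := by
  have hs0 := hs.1
  have hts : 0 < t - s := sub_pos.2 hs.2
  have ht : 0 < t / 2 := by linarith [hs.1, hs.2]
  have h1 : 0 ≤ s ^ (-b) := Real.rpow_nonneg hs0.le _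
  have h2 : 0 ≤ (t - s) ^ (-a) := Real.rpow_nonneg hts.le _
  have h3 : 0 ≤ (t / 2) ^ (-a) := Real.rpow_nonneg ht.le _
  have h4 : 0 ≤ (t / 2) ^ (-b) := Real.rpow_nonneg ht.le _
  rcases le_total (t / 2) (t - s) with h | h
  · have := Real.rpow_le_rpow_of_nonpos ht h (neg_nonpos.2 ha)
    nlinarith [mul_le_mul_of_nonneg_right this h1, mul_nonneg h4 h2]
  · have := Real.rpow_le_rpow_of_nonpos ht (show t / 2 ≤ s by linarith) (neg_nonpos.2 hb)
    nlinarith [mul_le_mul_of_nonneg_left this h2, mul_nonneg h3 h1]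

/-- Discards the null endpoint `s = t`, where the kernel is singular and the smoothing bounds do not
apply. -/
theorem ae_mem_Ioc_of_Ioo {P : ℝ → Prop}
    (h : ∀ᵐ s ∂(volume.restrict (Ioc 0 t)), s ∈ Ioo 0 t → P s) :
    ∀ᵐ s ∂(volume.restrict (Ioc 0 t)), P s := by
  rw [← restrict_Ioo_eq_restrict_Ioc] at h ⊢
  filter_upwards [h, ae_restrict_mem measurableSet_Ioo] with s hs hs'
  exact hs hs'

theorem intervalIntegrable_beta (ht : 0 ≤ t) (ha : 0 ≤ a) (ha1 : a < 1) (hb : 0 ≤ b) (hb1 : b < 1) :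
    IntervalIntegrable (fun s : ℝ => (t - s) ^ (-a) * s ^ (-b)) volume 0 t := by
  have hdom := ((intervalIntegrable_rpow_neg (t := t) hb1).const_mul ((t / 2) ^ (-a))).add
    ((intervalIntegrable_sub_rpow_neg (t := t) ha1).const_mul ((t / 2) ^ (-b)))
  rw [intervalIntegrable_iff_integrableOn_Ioc_of_le ht] at hdom ⊢
  refine Integrable.mono' hdom (by fun_prop) (ae_mem_Ioc_of_Ioo (ae_of_all _ fun s hs => ?_))
  have h1 : 0 ≤ s ^ (-b) := Real.rpow_nonneg hs.1.le _
  have h2 : 0 ≤ (t - s) ^ (-a) := Real.rpow_nonneg (sub_nonneg.2 hs.2.le) _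
  rw [Real.norm_of_nonneg (mul_nonneg h2 h1)]
  exact rpow_mul_rpow_le ha hb hs

theorem integral_beta_le (ht : 0 < t) (ha : 0 ≤ a) (ha1 : a < 1) (hb : 0 ≤ b) (hb1 : b < 1) :
    ∫ s in (0 : ℝ)..t, (t - s) ^ (-a) * s ^ (-b) ≤ betaConst a b * t ^ (1 - a - b) := by
  have hi1 := (intervalIntegrable_rpow_neg (t := t) hb1).const_mul ((t / 2) ^ (-a))
  have hi2 := (intervalIntegrable_sub_rpow_neg (t := t) ha1).const_mul ((t / 2) ^ (-b))
  calc ∫ s in (0 : ℝ)..t, (t - s) ^ (-a) * s ^ (-b)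
      ≤ ∫ s in (0 : ℝ)..t, ((t / 2) ^ (-a) * s ^ (-b) + (t / 2) ^ (-b) * (t - s) ^ (-a)) :=
        intervalIntegral.integral_mono_on_of_le_Ioo ht.le
          (intervalIntegrable_beta ht.le ha ha1 hb hb1) (hi1.add hi2)
          fun s hs => rpow_mul_rpow_le ha hb hs
    _ = (t / 2) ^ (-a) * (t ^ (1 - b) / (1 - b)) + (t / 2) ^ (-b) * (t ^ (1 - a) / (1 - a)) := by
        rw [intervalIntegral.integral_add hi1 hi2, intervalIntegral.integral_const_mul,
          intervalIntegral.integral_const_mul, integral_rpow_neg hb1, integral_sub_rpow_neg ha1]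
    _ = betaConst a b * t ^ (1 - a - b) := by
        have h1 : ∀ c : ℝ, (t / 2) ^ (-c) = 2 ^ c * t ^ (-c) := fun c => by
          rw [Real.div_rpow ht.le two_pos.le, Real.rpow_neg two_pos.le, div_inv_eq_mul, mul_comm]
        have h2 : t ^ (1 - a - b) = t ^ (-a) * t ^ (1 - b) := by
          rw [← Real.rpow_add ht]; ring_nf
        have h3 : t ^ (1 - a - b) = t ^ (-b) * t ^ (1 - a) := by
          rw [← Real.rpow_add ht]; ring_nf
        rw [betaConst, add_mul]
        nth_rw 1 [h2]
        rw [h3, h1, h1]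
        ring

end Beta

theorem exp_neg_mul_le {l r e : ℝ} (hl : 0 < l) (hr : 0 < r) (he0 : 0 ≤ e) (he1 : e ≤ 1) :
    Real.exp (-(l * r)) ≤ l ^ (-e) * r ^ (-e) := by
  have hlr := mul_pos hl hr
  rw [← Real.mul_rpow hl.le hr.le, Real.rpow_neg hlr.le, Real.exp_neg]
  refine inv_anti₀ (Real.rpow_pos_of_pos hlr _) ?_
  rcases le_total (l * r) 1 with h | h
  · exact (Real.rpow_le_one hlr.le h he0).trans (Real.one_le_exp hlr.le)
  · refine (Real.rpow_le_rpow_of_exponent_le h he1).trans ?_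
    rw [Real.rpow_one]
    linarith [Real.add_one_le_exp (l * r)]

/-- Writing `e^{ls} = e^{lt} e^{-l(t-s)}`, the decaying factor is at most `l^(-e) (t-s)^(-e)`. A
slightly stronger singularity in time thus buys the small factor `l^(-e)`, which is the source of
the contraction. -/
theorem exp_mul_kernel_le {l t s e a b : ℝ} (hl : 0 < l) (he0 : 0 ≤ e) (he1 : e ≤ 1)
    (hs : s ∈ Ioo 0 t) :
    Real.exp (l * s) * ((t - s) ^ (-a) * s ^ (-b)) ≤
      Real.exp (l * t) * l ^ (-e) * ((t - s) ^ (-(a + e)) * s ^ (-b)) := by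
  have hts : 0 < t - s := sub_pos.2 hs.2
  have h1 : 0 ≤ s ^ (-b) := Real.rpow_nonneg hs.1.le _
  have h2 : 0 ≤ (t - s) ^ (-a) := Real.rpow_nonneg hts.le _
  have h3 : Real.exp (l * s) = Real.exp (l * t) * Real.exp (-(l * (t - s))) := by
    rw [← Real.exp_add]; ring_nf
  have h4 : (t - s) ^ (-(a + e)) = (t - s) ^ (-e) * (t - s) ^ (-a) := by
    rw [← Real.rpow_add hts]; ring_nf
  rw [h3, h4]
  calc _ ≤ Real.exp (l * t) * (l ^ (-e) * (t - s) ^ (-e)) * ((t - s) ^ (-a) * s ^ (-b)) := by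
        gcongr
        exact exp_neg_mul_le hl hts he0 he1
    _ = _ := by ring

/-! ### The Duhamel operator -/

/-- Each truncation is a continuous linear map on `L²`, so it commutes with the Bochner integral;
this is why gradient bounds are phrased through `truncGrad` rather than through an unbounded
operator. -/
theorem GradBound.intervalIntegral {y : ℝ → L2} {g : ℝ → ℝ} {t : ℝ} (ht : 0 ≤ t)
    (hy : IntervalIntegrable y volume 0 t) (hg : IntervalIntegrable g volume 0 t)
    (h : ∀ᵐ s ∂(volume.restrict (Ioc 0 t)), GradBound (y s) (g s)) :
    GradBound (∫ s in (0 : ℝ)..t, y s) (∫ s in (0 : ℝ)..t, g s) := fun S => by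
  rw [← ContinuousLinearMap.intervalIntegral_comp_comm _ hy]
  refine intervalIntegral.norm_integral_le_of_norm_le ht ?_ hg
  rw [← ae_restrict_iff' measurableSet_Ioc]
  filter_upwards [h] with s hs
  exact hs S

/-- The right-hand side of the mild formulation, where `G` plays the role of `∇u`. -/
noncomputable def duhamel (p : ℝ) (v : ℝ → L2Vec) (u₀ : L2) (G : ℝ → L2Vec) (t : ℝ) : L2 :=
  heat t (coeff u₀) - (∫ s in (0 : ℝ)..t, heat (t - s) (fluxSource p (G s)))
    - ∫ s in (0 : ℝ)..t, heat (t - s) (transportSource (v s) (G s))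

/-- Both integrals of the mild formulation exist. -/
def DuhamelIntegrable (p : ℝ) (v : ℝ → L2Vec) (G : ℝ → L2Vec) (t : ℝ) : Prop :=
  IntervalIntegrable (fun s => heat (t - s) (fluxSource p (G s))) volume 0 t ∧
    IntervalIntegrable (fun s => heat (t - s) (transportSource (v s) (G s))) volume 0 t

section Core

variable {p M b L s : ℝ}

theorem norm_fluxSource_sub_le_rpow {G H : L2Vec} (hp₂ : 2 ≤ p) (hp₃ : p ≤ 3) (hM : 0 < M)
    (hs : 0 < s) (hG : ‖G‖ ≤ M * s ^ (-(1 / 4) : ℝ)) (hH : ‖H‖ ≤ M * s ^ (-(1 / 4) : ℝ))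
    (hGH : ‖G - H‖ ≤ L * s ^ (-(1 / 4) : ℝ)) (k : Fin 2 → ℤ) :
    ‖fluxSource p G k - fluxSource p H k‖ ≤
      8 * (2 * M) ^ (p - 2) * L * s ^ (-((p - 1) / 4)) * freq k ^ 1 := by
  have hs4 : 0 < s ^ (-(1 / 4) : ℝ) := Real.rpow_pos_of_pos hs _
  refine (norm_fluxSource_sub_le hp₂ hp₃ (A := 2 * M * s ^ (-(1 / 4) : ℝ)) (by positivity)
    (by linarith) k).trans ?_
  have h1 : (2 * M * s ^ (-(1 / 4) : ℝ)) ^ (p - 2) * s ^ (-(1 / 4) : ℝ) =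
      (2 * M) ^ (p - 2) * s ^ (-((p - 1) / 4)) := by
    rw [Real.mul_rpow (by positivity) hs4.le, ← Real.rpow_mul hs.le, mul_assoc, ← Real.rpow_add hs]
    ring_nf
  have hf : 0 ≤ freq k ^ 1 := pow_nonneg (freq_nonneg k) 1
  calc _ ≤ 8 * (2 * M * s ^ (-(1 / 4) : ℝ)) ^ (p - 2) * (L * s ^ (-(1 / 4) : ℝ)) * freq k ^ 1 := by
        gcongr
    _ = 8 * L * ((2 * M * s ^ (-(1 / 4) : ℝ)) ^ (p - 2) * s ^ (-(1 / 4) : ℝ)) * freq k ^ 1 := by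
        ring
    _ = _ := by rw [h1]; ring

theorem norm_transportSource_sub_le {V G H : L2Vec} (hV : ‖V‖ ≤ b)
    (hGH : ‖G - H‖ ≤ L * s ^ (-(1 / 4) : ℝ)) (k : Fin 2 → ℤ) :
    ‖transportSource V G k - transportSource V H k‖ ≤
      b * L * s ^ (-(1 / 4) : ℝ) * freq k ^ 0 := by
  rw [transportSource_sub]
  refine (norm_transportSource_le V _ k).trans ?_
  rw [pow_zero, mul_one, mul_one, mul_assoc]
  have := (norm_nonneg V).trans hV
  gcongr

/-- The constant of the difference estimate for the Duhamel operator. -/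
noncomputable def coreConst (p b M : ℝ) : ℝ :=
  (8 * (2 * M) ^ (p - 2) * kernelConst 2 + b * kernelConst 1) *
    betaConst (3 / 4 + (3 - p) / 4) ((p - 1) / 4)

/-- The difference estimate: the gradient of the Duhamel operator is a contraction with respect to
exponentially weighted norms. -/
theorem gradBound_duhamel_sub {K l t : ℝ} {v G H : ℝ → L2Vec} {u₀ : L2} (hp₂ : 2 < p) (hp₃ : p < 3)
    (hM : 0 < M) (hK : 0 ≤ K) (hb : 0 ≤ b) (hl : 0 < l) (ht : 0 < t) (ht1 : t ≤ 1)
    (hiG : DuhamelIntegrable p v G t) (hiH : DuhamelIntegrable p v H t)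
    (hv : ∀ᵐ s ∂(volume.restrict (Ioc 0 t)), ‖v s‖ ≤ b)
    (hG : ∀ᵐ s ∂(volume.restrict (Ioc 0 t)), ‖G s‖ ≤ M * s ^ (-(1 / 4) : ℝ))
    (hH : ∀ᵐ s ∂(volume.restrict (Ioc 0 t)), ‖H s‖ ≤ M * s ^ (-(1 / 4) : ℝ))
    (hGH : ∀ᵐ s ∂(volume.restrict (Ioc 0 t)),
      ‖G s - H s‖ ≤ K * Real.exp (l * s) * s ^ (-(1 / 4) : ℝ)) :
    GradBound (duhamel p v u₀ G t - duhamel p v u₀ H t)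
      (coreConst p b M * l ^ (-((3 - p) / 4)) * (K * Real.exp (l * t) * t ^ (-(1 / 4) : ℝ))) := by
  -- `3/4` is the cost of two derivatives from `L¹` to `L²`; the spare `(3 - p) / 4` is traded for
  -- decay in `l`. The sum is below `1` exactly because `p > 2`.
  set a := 3 / 4 + (3 - p) / 4
  set β := (p - 1) / 4
  have ha0 : 0 ≤ a := by simp only [a]; linarith
  have ha1 : a < 1 := by simp only [a]; linarith
  have hβ0 : 0 ≤ β := by simp only [β]; linarith
  have hβ1 : β < 1 := by simp only [β]; linarith
  have hk1 := (kernelConst_pos 1).le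
  have hk2 := (kernelConst_pos 2).le
  have hM2 : 0 ≤ (2 * M) ^ (p - 2) := by positivity
  set W := Real.exp (l * t) * l ^ (-((3 - p) / 4))
  have hW : 0 ≤ W := mul_nonneg (Real.exp_pos _).le (Real.rpow_nonneg hl.le _)
  have hker := intervalIntegrable_beta ht.le ha0 ha1 hβ0 hβ1
  have hbeta := integral_beta_le ht ha0 ha1 hβ0 hβ1
  have h1 : GradBound (∫ s in (0 : ℝ)..t,
      (heat (t - s) (fluxSource p (H s)) - heat (t - s) (fluxSource p (G s))))
      (∫ s in (0 : ℝ)..t, (8 * (2 * M) ^ (p - 2) * kernelConst 2 * K * W) *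
        ((t - s) ^ (-a) * s ^ (-β))) := by
    refine GradBound.intervalIntegral ht.le (hiH.1.sub hiG.1) (hker.const_mul _)
      (ae_mem_Ioc_of_Ioo ?_)
    filter_upwards [hG, hH, hGH] with s hGs hHs hGHs hs
    have hts : 0 < t - s := sub_pos.2 hs.2
    have hts1 : t - s ≤ 1 := by linarith [hs.1]
    have hs4 : 0 ≤ s ^ (-(1 / 4) : ℝ) := Real.rpow_nonneg hs.1.le _
    have hN := fun G (hG : ‖G‖ ≤ M * s ^ (-(1 / 4) : ℝ)) =>
      norm_fluxSource_le hp₂.le hp₃.le (mul_pos hM (Real.rpow_pos_of_pos hs.1 _)) hG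
    rw [heat_sub hts hts1 (hN _ hHs) (hN _ hGs)]
    rw [norm_sub_rev] at hGHs
    have hd := norm_fluxSource_sub_le_rpow hp₂.le hp₃.le hM hs.1 hHs hGs hGHs
    have hβs : 0 ≤ s ^ (-β) := Real.rpow_nonneg hs.1.le _
    refine (gradBound_heat hts hts1 (by positivity) hd ((isHermitianSeq_fluxSource p _).sub
      (isHermitianSeq_fluxSource p _))).mono ?_
    have he : (-(((1 : ℕ) + 2 : ℝ) / 4)) = -(3 / 4) := by norm_num
    rw [he]
    calc _ = 8 * (2 * M) ^ (p - 2) * kernelConst 2 * K *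
          (Real.exp (l * s) * ((t - s) ^ (-(3 / 4) : ℝ) * s ^ (-β))) := by ring
      _ ≤ 8 * (2 * M) ^ (p - 2) * kernelConst 2 * K * (W * ((t - s) ^ (-a) * s ^ (-β))) := by
          refine mul_le_mul_of_nonneg_left ?_ (by positivity)
          exact exp_mul_kernel_le (e := (3 - p) / 4) (a := 3 / 4) hl (by linarith) (by linarith) hs
      _ = _ := by ring
  have h2 : GradBound (∫ s in (0 : ℝ)..t,
      (heat (t - s) (transportSource (v s) (H s)) - heat (t - s) (transportSource (v s) (G s))))
      (∫ s in (0 : ℝ)..t, (b * kernelConst 1 * K * W) * ((t - s) ^ (-a) * s ^ (-β))) := by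
    refine GradBound.intervalIntegral ht.le (hiH.2.sub hiG.2) (hker.const_mul _)
      (ae_mem_Ioc_of_Ioo ?_)
    filter_upwards [hGH, hv] with s hGHs hvs hs
    have hts : 0 < t - s := sub_pos.2 hs.2
    have hts1 : t - s ≤ 1 := by linarith [hs.1]
    have hs4 : 0 ≤ s ^ (-(1 / 4) : ℝ) := Real.rpow_nonneg hs.1.le _
    rw [heat_sub hts hts1 (norm_transportSource_le _ _) (norm_transportSource_le _ _)]
    rw [norm_sub_rev] at hGHs
    have hd := norm_transportSource_sub_le hvs hGHs
    have hβs : 0 ≤ s ^ (-β) := Real.rpow_nonneg hs.1.le _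
    refine (gradBound_heat hts hts1 (by positivity) hd ((isHermitianSeq_transportSource _ _).sub
      (isHermitianSeq_transportSource _ _))).mono ?_
    have he : (-(((0 : ℕ) + 2 : ℝ) / 4)) = -(1 / 2) := by norm_num
    rw [he, zero_add]
    -- The transport term is less singular; as times are at most `1`, it is dominated by the flux
    -- kernel, so that one Beta integral serves both.
    have hc1 : (t - s) ^ (-(1 / 2) : ℝ) ≤ (t - s) ^ (-(3 / 4) : ℝ) :=
      Real.rpow_le_rpow_of_exponent_ge hts hts1 (by norm_num)
    have hc2 : s ^ (-(1 / 4) : ℝ) ≤ s ^ (-β) :=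
      Real.rpow_le_rpow_of_exponent_ge hs.1 (by linarith [hs.2]) (by simp only [β]; linarith)
    have hc3 : 0 ≤ (t - s) ^ (-(3 / 4) : ℝ) := Real.rpow_nonneg hts.le _
    calc _ = b * kernelConst 1 * K *
          (Real.exp (l * s) * ((t - s) ^ (-(1 / 2) : ℝ) * s ^ (-(1 / 4) : ℝ))) := by ring
      _ ≤ b * kernelConst 1 * K * (Real.exp (l * s) * ((t - s) ^ (-(3 / 4) : ℝ) * s ^ (-β))) := by
          gcongr
      _ ≤ b * kernelConst 1 * K * (W * ((t - s) ^ (-a) * s ^ (-β))) := by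
          refine mul_le_mul_of_nonneg_left ?_ (by positivity)
          exact exp_mul_kernel_le (e := (3 - p) / 4) (a := 3 / 4) hl (by linarith) (by linarith) hs
      _ = _ := by ring
  have h3 : duhamel p v u₀ G t - duhamel p v u₀ H t = (∫ s in (0 : ℝ)..t,
      (heat (t - s) (fluxSource p (H s)) - heat (t - s) (fluxSource p (G s)))) +
      ∫ s in (0 : ℝ)..t, (heat (t - s) (transportSource (v s) (H s)) -
        heat (t - s) (transportSource (v s) (G s))) := by
    rw [intervalIntegral.integral_sub hiH.1 hiG.1, intervalIntegral.integral_sub hiH.2 hiG.2,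
      duhamel, duhamel]
    abel
  rw [h3]
  refine (h1.add h2).mono ?_
  rw [intervalIntegral.integral_const_mul, intervalIntegral.integral_const_mul, ← add_mul]
  -- All of the spare power has been spent, so the integral reproduces exactly the weight
  -- `t^(-1/4)`.
  have h4 : 1 - a - β = -(1 / 4) := by simp only [a, β]; ring
  rw [h4] at hbeta
  calc _ ≤ (8 * (2 * M) ^ (p - 2) * kernelConst 2 * K * W + b * kernelConst 1 * K * W) *
        (betaConst a β * t ^ (-(1 / 4) : ℝ)) := by gcongr
    _ = _ := by simp only [coreConst, W, a, β]; ring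

end Core

end ThinFilm

namespace ThinFilm

open UnitAddTorus Filter Topology

/-! ### Measurability and integrability of the Duhamel integrands -/

/-- The synthesis is the limit of its finite partial sums, so measurability in time reduces to
single coefficients. -/
theorem aestronglyMeasurable_invFourier {α : Type*} [MeasurableSpace α] {μ : Measure α}
    {c : α → (Fin 2 → ℤ) → ℂ} (hm : ∀ k, AEStronglyMeasurable (fun a => c a k) μ)
    (hs : ∀ᵐ a ∂μ, Summable fun k => ‖c a k‖ ^ 2) :
    AEStronglyMeasurable (fun a => invFourier (c a)) μ := by
  refine aestronglyMeasurable_of_tendsto_ae atTop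
    (f := fun (S : Finset (Fin 2 → ℤ)) a =>
      ∑ k ∈ S, Complex.reCLM.compLpL 2 volume (c a k • mFourierLp 2 k)) (fun S => ?_) ?_
  · refine Finset.aestronglyMeasurable_fun_sum S fun k _ => ?_
    exact (ContinuousLinearMap.continuous _).comp_aestronglyMeasurable ((hm k).smul_const _)
  · filter_upwards [hs] with a ha
    exact hasSum_invFourier ha

theorem continuous_fluxSource {p : ℝ} (hp₂ : 2 ≤ p) (hp₃ : p ≤ 3) (k : Fin 2 → ℤ) :
    Continuous fun G : L2Vec => fluxSource p G k := by
  refine continuous_iff_continuousAt.2 fun G => ?_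
  rw [ContinuousAt, tendsto_iff_norm_sub_tendsto_zero]
  have hlim : Tendsto (fun H : L2Vec => 8 * (‖H‖ + ‖G‖ + 1) ^ (p - 2) * ‖H - G‖ * freq k ^ 1)
      (𝓝 G) (𝓝 (8 * (‖G‖ + ‖G‖ + 1) ^ (p - 2) * ‖G - G‖ * freq k ^ 1)) := by
    refine Continuous.tendsto ?_ G
    have : Continuous fun H : L2Vec => (‖H‖ + ‖G‖ + 1) ^ (p - 2) :=
      Continuous.rpow_const (by fun_prop) fun _ => Or.inr (by linarith)
    fun_prop
  rw [sub_self, norm_zero, mul_zero, zero_mul] at hlim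
  exact squeeze_zero (fun _ => norm_nonneg _)
    (fun H => norm_fluxSource_sub_le hp₂ hp₃ (by positivity) (by linarith) k) hlim

theorem transportSource_sub_left (V W G : L2Vec) (k : Fin 2 → ℤ) :
    transportSource V G k - transportSource W G k = transportSource (V - W) G k := by
  rw [transportSource, transportSource, ← coeff_sub (integrable_inner V G) (integrable_inner W G)]
  refine coeff_congr ?_ k
  filter_upwards [Lp.coeFn_sub V W] with x hx
  rw [hx, Pi.sub_apply, inner_sub_left]

theorem continuous_transportSource (k : Fin 2 → ℤ) :
    Continuous fun q : L2Vec × L2Vec => transportSource q.1 q.2 k := by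
  refine continuous_iff_continuousAt.2 fun q => ?_
  rw [ContinuousAt, tendsto_iff_norm_sub_tendsto_zero]
  have hlim : Tendsto (fun r : L2Vec × L2Vec => ‖r.1‖ * ‖r.2 - q.2‖ + ‖r.1 - q.1‖ * ‖q.2‖)
      (𝓝 q) (𝓝 (‖q.1‖ * ‖q.2 - q.2‖ + ‖q.1 - q.1‖ * ‖q.2‖)) :=
    Continuous.tendsto (by fun_prop) q
  simp only [sub_self, norm_zero, mul_zero, zero_mul, add_zero] at hlim
  refine squeeze_zero (fun _ => norm_nonneg _) (fun r => ?_) hlim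
  have h : transportSource r.1 r.2 k - transportSource q.1 q.2 k =
      transportSource r.1 (r.2 - q.2) k + transportSource (r.1 - q.1) q.2 k := by
    rw [← transportSource_sub, ← transportSource_sub_left]
    ring
  rw [h]
  refine (norm_add_le _ _).trans (add_le_add ?_ ?_)
  · simpa using norm_transportSource_le r.1 (r.2 - q.2) k
  · simpa using norm_transportSource_le (r.1 - q.1) q.2 k

/-- Assumptions on `G` (playing the role of `∇u`) and on the velocity up to the time `T`. -/
structure Admissible (v : ℝ → L2Vec) (b M T : ℝ) (G : ℝ → L2Vec) : Prop where
  aesm_velocity : AEStronglyMeasurable v (volume.restrict (Ioc 0 T))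
  norm_velocity_le : ∀ᵐ s ∂(volume.restrict (Ioc 0 T)), ‖v s‖ ≤ b
  aesm : AEStronglyMeasurable G (volume.restrict (Ioc 0 T))
  norm_le : ∀ᵐ s ∂(volume.restrict (Ioc 0 T)), ‖G s‖ ≤ M * s ^ (-(1 / 4) : ℝ)

section Admissible

variable {p b M T t : ℝ} {v G : ℝ → L2Vec} {u₀ : L2}

theorem Admissible.mono (h : Admissible v b M T G) (ht : t ≤ T) : Admissible v b M t G :=
  have hμ := Measure.restrict_mono_set (volume : Measure ℝ) (Ioc_subset_Ioc (le_refl (0 : ℝ)) ht)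
  ⟨h.1.mono_measure hμ, ae_mono hμ h.2, h.3.mono_measure hμ, ae_mono hμ h.4⟩

theorem Admissible.norm_fluxSource_le (h : Admissible v b M T G) (hp₂ : 2 ≤ p) (hp₃ : p ≤ 3)
    (hM : 0 < M) : ∀ᵐ s ∂(volume.restrict (Ioc 0 T)), ∀ k, ‖fluxSource p (G s) k‖ ≤
      8 * (2 * M) ^ (p - 2) * M * s ^ (-((p - 1) / 4)) * freq k ^ 1 := by
  filter_upwards [h.norm_le, ae_restrict_mem measurableSet_Ioc] with s hs hs0 k
  have h0 : 0 ≤ M * s ^ (-(1 / 4) : ℝ) := (norm_nonneg _).trans hs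
  simpa [fluxSource_zero] using norm_fluxSource_sub_le_rpow (H := 0) hp₂ hp₃ hM hs0.1 hs
    (by simpa using h0) (by simpa using hs) k

theorem Admissible.norm_transportSource_le (h : Admissible v b M T G) :
    ∀ᵐ s ∂(volume.restrict (Ioc 0 T)), ∀ k, ‖transportSource (v s) (G s) k‖ ≤
      b * M * s ^ (-(1 / 4) : ℝ) * freq k ^ 0 := by
  filter_upwards [h.norm_le, h.norm_velocity_le] with s hs hv k
  simpa [transportSource_zero] using norm_transportSource_sub_le (H := 0) hv (by simpa using hs) k

theorem Admissible.aesm_fluxSource (h : Admissible v b M T G) (hp₂ : 2 ≤ p) (hp₃ : p ≤ 3)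
    (k : Fin 2 → ℤ) :
    AEStronglyMeasurable (fun s => fluxSource p (G s) k) (volume.restrict (Ioc 0 T)) :=
  (continuous_fluxSource hp₂ hp₃ k).comp_aestronglyMeasurable h.aesm

theorem Admissible.aesm_transportSource (h : Admissible v b M T G) (k : Fin 2 → ℤ) :
    AEStronglyMeasurable (fun s => transportSource (v s) (G s) k) (volume.restrict (Ioc 0 T)) :=
  Continuous.comp_aestronglyMeasurable (g := fun q : L2Vec × L2Vec => transportSource q.1 q.2 k)
    (f := fun s => (v s, G s)) (continuous_transportSource k) (h.aesm_velocity.prodMk h.aesm)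

/-- The Duhamel integral of a source term bounded by a power of time. -/
theorem intervalIntegrable_heat {m : ℕ} {C β : ℝ} {N : ℝ → (Fin 2 → ℤ) → ℂ} (ht : 0 < t)
    (ht1 : t ≤ 1) (hC : 0 ≤ C) (hβ0 : 0 ≤ β) (hβ1 : β < 1) (hm : m < 3)
    (hN : ∀ k, AEStronglyMeasurable (fun s => N s k) (volume.restrict (Ioc 0 t)))
    (hb : ∀ᵐ s ∂(volume.restrict (Ioc 0 t)), ∀ k, ‖N s k‖ ≤ C * s ^ (-β) * freq k ^ m) :
    IntervalIntegrable (fun s => heat (t - s) (N s)) volume 0 t ∧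
      ‖∫ s in (0 : ℝ)..t, heat (t - s) (N s)‖ ≤ C * kernelConst m *
        (betaConst ((m + 1 : ℝ) / 4) β * t ^ (1 - (m + 1 : ℝ) / 4 - β)) := by
  have hm0 : (0 : ℝ) ≤ (m + 1 : ℝ) / 4 := by positivity
  -- The condition `m < 3` is exactly integrability of the smoothing kernel at `s = t`.
  have hm1 : (m + 1 : ℝ) / 4 < 1 := by
    have : (m : ℝ) < 3 := by exact_mod_cast hm
    linarith
  have hk := (kernelConst_pos m).le
  have hdom := (intervalIntegrable_beta ht.le hm0 hm1 hβ0 hβ1).const_mul (C * kernelConst m)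
  have hmeas : AEStronglyMeasurable (fun s => heat (t - s) (N s)) (volume.restrict (Ioc 0 t)) := by
    refine aestronglyMeasurable_invFourier (fun k => ?_) (ae_mem_Ioc_of_Ioo ?_)
    · exact (Continuous.aestronglyMeasurable (by fun_prop)).mul (hN k)
    · filter_upwards [hb] with s hs hs0
      exact summable_heat (sub_pos.2 hs0.2) (by linarith [hs0.1]) hs
  have hle : ∀ᵐ s ∂(volume.restrict (Ioc 0 t)), ‖heat (t - s) (N s)‖ ≤
      C * kernelConst m * ((t - s) ^ (-((m + 1 : ℝ) / 4)) * s ^ (-β)) := by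
    refine ae_mem_Ioc_of_Ioo ?_
    filter_upwards [hb] with s hs hs0
    have h0 : 0 ≤ s ^ (-β) := Real.rpow_nonneg hs0.1.le _
    refine (norm_heat_le (sub_pos.2 hs0.2) (by linarith [hs0.1]) (by positivity) hs).trans_eq ?_
    ring
  refine ⟨?_, ?_⟩
  · rw [intervalIntegrable_iff_integrableOn_Ioc_of_le ht.le] at hdom ⊢
    exact Integrable.mono' hdom hmeas hle
  · refine (intervalIntegral.norm_integral_le_of_norm_le ht.le
      ((ae_restrict_iff' measurableSet_Ioc).1 hle) hdom).trans ?_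
    rw [intervalIntegral.integral_const_mul]
    gcongr
    exact integral_beta_le ht hm0 hm1 hβ0 hβ1

theorem Admissible.duhamelIntegrable (h : Admissible v b M t G) (hp₂ : 2 < p) (hp₃ : p < 3)
    (hM : 0 < M) (hb : 0 ≤ b) (ht : 0 < t) (ht1 : t ≤ 1) : DuhamelIntegrable p v G t :=
  ⟨(intervalIntegrable_heat ht ht1 (by positivity) (by linarith) (by linarith) (by norm_num)
      (h.aesm_fluxSource hp₂.le hp₃.le) (h.norm_fluxSource_le hp₂.le hp₃.le hM)).1,
    (intervalIntegrable_heat ht ht1 (by positivity) (by norm_num) (by norm_num) (by norm_num)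
      h.aesm_transportSource h.norm_transportSource_le).1⟩

/-- Both powers of `t` are positive, so the integral terms vanish as `t → 0`; this gives continuity
at the initial time. -/
theorem Admissible.norm_duhamel_sub_le (h : Admissible v b M t G) (hp₂ : 2 < p) (hp₃ : p < 3)
    (hM : 0 < M) (hb : 0 ≤ b) (ht : 0 < t) (ht1 : t ≤ 1) :
    ‖duhamel p v u₀ G t - heat t (coeff u₀)‖ ≤
      8 * (2 * M) ^ (p - 2) * M * kernelConst 1 *
        (betaConst (1 / 2) ((p - 1) / 4) * t ^ ((3 - p) / 4)) +
      b * M * kernelConst 0 * (betaConst (1 / 4) (1 / 4) * t ^ (1 / 2 : ℝ)) := by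
  have h1 := (intervalIntegrable_heat ht ht1 (by positivity) (by linarith) (by linarith)
    (by norm_num) (h.aesm_fluxSource hp₂.le hp₃.le) (h.norm_fluxSource_le hp₂.le hp₃.le hM)).2
  have h2 := (intervalIntegrable_heat ht ht1 (by positivity) (by norm_num) (by norm_num)
    (by norm_num) h.aesm_transportSource h.norm_transportSource_le).2
  have e1 : ((1 : ℕ) + 1 : ℝ) / 4 = 1 / 2 := by norm_num
  have e2 : ((0 : ℕ) + 1 : ℝ) / 4 = 1 / 4 := by norm_num
  have e3 : 1 - 1 / 2 - (p - 1) / 4 = (3 - p) / 4 := by ring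
  have e4 : (1 - 1 / 4 - 1 / 4 : ℝ) = 1 / 2 := by norm_num
  rw [e1, e3] at h1
  rw [e2, e4] at h2
  have h3 : ∀ x y z : L2, x - y - z - x = -(y + z) := fun x y z => by abel
  rw [duhamel, h3, norm_neg]
  exact (norm_add_le _ _).trans (add_le_add h1 h2)

/-! ### Continuity in time -/

/-- At a fixed frequency `e^{-tl}` factors out, leaving the primitive of an integrable function. -/
theorem continuousOn_integral_exp {N : ℝ → ℂ} (hT : 0 ≤ T) (hN : IntegrableOn N (Ioc 0 T))
    (l : ℝ) : ContinuousOn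
      (fun t : ℝ => ∫ s in (0 : ℝ)..t, (Real.exp (-(t - s) * l) : ℂ) * N s) (Icc 0 T) := by
  have h1 : ∀ t : ℝ, ∫ s in (0 : ℝ)..t, (Real.exp (-(t - s) * l) : ℂ) * N s =
      (Real.exp (-t * l) : ℂ) * ∫ s in (0 : ℝ)..t, (Real.exp (s * l) : ℂ) * N s := fun t => by
    rw [← intervalIntegral.integral_const_mul]
    congr 1
    ext s
    rw [← mul_assoc, ← Complex.ofReal_mul, ← Real.exp_add]
    ring_nf
  simp only [h1]
  refine (Continuous.continuousOn (by fun_prop)).mul ?_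
  have h2 : IntegrableOn (fun s : ℝ => (Real.exp (s * l) : ℂ) * N s) (uIcc 0 T) := by
    rw [uIcc_of_le hT]
    refine IntegrableOn.continuousOn_mul (Continuous.continuousOn (by fun_prop)) ?_ isCompact_Icc
    rwa [integrableOn_Icc_iff_integrableOn_Ioc]
  have := intervalIntegral.continuousOn_primitive_interval h2
  rwa [uIcc_of_le hT] at this

theorem integrableOn_source {m : ℕ} {C β : ℝ} {N : ℝ → (Fin 2 → ℤ) → ℂ} (hT : 0 ≤ T)
    (hβ1 : β < 1) (k : Fin 2 → ℤ)
    (hN : AEStronglyMeasurable (fun s => N s k) (volume.restrict (Ioc 0 T)))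
    (hb : ∀ᵐ s ∂(volume.restrict (Ioc 0 T)), ∀ k, ‖N s k‖ ≤ C * s ^ (-β) * freq k ^ m) :
    IntegrableOn (fun s => N s k) (Ioc 0 T) := by
  have := ((intervalIntegrable_rpow_neg (t := T) hβ1).const_mul C).mul_const (freq k ^ m)
  rw [intervalIntegrable_iff_integrableOn_Ioc_of_le hT] at this
  exact Integrable.mono' this hN (hb.mono fun s hs => hs k)

theorem coeff_integral_heat {m : ℕ} {C β : ℝ} {N : ℝ → (Fin 2 → ℤ) → ℂ} (ht : 0 < t)
    (ht1 : t ≤ 1) (hi : IntervalIntegrable (fun s => heat (t - s) (N s)) volume 0 t)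
    (hs : ∀ s, IsHermitianSeq (N s))
    (hb : ∀ᵐ s ∂(volume.restrict (Ioc 0 t)), ∀ k, ‖N s k‖ ≤ C * s ^ (-β) * freq k ^ m)
    (k : Fin 2 → ℤ) : coeff (∫ s in (0 : ℝ)..t, heat (t - s) (N s) : L2) k =
      ∫ s in (0 : ℝ)..t, (Real.exp (-(t - s) * bilaplacianSymbol k) : ℂ) * N s k := by
  rw [← coeffCLM_apply, ← ContinuousLinearMap.intervalIntegral_comp_comm _ hi]
  refine intervalIntegral.integral_congr_ae ?_
  rw [uIoc_of_le ht.le, ← ae_restrict_iff' measurableSet_Ioc]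
  refine ae_mem_Ioc_of_Ioo ?_
  filter_upwards [hb] with s hbs hs0
  rw [coeffCLM_apply, coeff_heat (sub_pos.2 hs0.2) (by linarith [hs0.1]) hbs (hs s)]

theorem norm_exp_neg_le (ht : 0 ≤ t) (k : Fin 2 → ℤ) :
    ‖(Real.exp (-t * bilaplacianSymbol k) : ℂ)‖ ≤ 1 := by
  rw [norm_ofReal_exp, Real.exp_le_one_iff]
  nlinarith [mul_nonneg ht (bilaplacianSymbol_nonneg k)]

theorem coeff_heat_coeff (ht : 0 ≤ t) (u : L2) (k : Fin 2 → ℤ) :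
    coeff (heat t (coeff u)) k = (Real.exp (-t * bilaplacianSymbol k) : ℂ) * coeff u k :=
  coeff_invFourier (summable_sq_mul (summable_coeff u) (norm_exp_neg_le ht))
    (isHermitianSeq_exp_mul t (isHermitianSeq_coeff u)) k

theorem coeff_L2_sub (z w : L2) (k : Fin 2 → ℤ) :
    coeff (z - w : L2) k = coeff z k - coeff w k := by
  simp only [← coeffCLM_apply, map_sub]

theorem heat_zero_coeff (u : L2) : heat 0 (coeff u) = u := by
  rw [heat]
  simp [invFourier_coeff]

theorem duhamel_zero (p : ℝ) (v : ℝ → L2Vec) (u₀ : L2) (G : ℝ → L2Vec) :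
    duhamel p v u₀ G 0 = u₀ := by
  simp [duhamel, heat_zero_coeff]

theorem Admissible.continuousOn_coeff (h : Admissible v b M T G) (hp₂ : 2 < p) (hp₃ : p < 3)
    (hM : 0 < M) (hb : 0 ≤ b) (hT : 0 < T) (hT1 : T ≤ 1) (k : Fin 2 → ℤ) :
    ContinuousOn (fun t => coeff (duhamel p v u₀ G t) k) (Icc 0 T) := by
  have h1 := continuousOn_integral_exp hT.le (integrableOn_source hT.le (by linarith) k
    (h.aesm_fluxSource hp₂.le hp₃.le k) (h.norm_fluxSource_le hp₂.le hp₃.le hM))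
    (bilaplacianSymbol k)
  have h2 := continuousOn_integral_exp hT.le (integrableOn_source hT.le (by norm_num) k
    (h.aesm_transportSource k) h.norm_transportSource_le) (bilaplacianSymbol k)
  have h0 : Continuous fun t : ℝ => (Real.exp (-t * bilaplacianSymbol k) : ℂ) * coeff u₀ k := by
    fun_prop
  refine ((h0.continuousOn.sub h1).sub h2).congr fun t ht => ?_
  rcases ht.1.eq_or_lt with rfl | ht0
  · simp [duhamel_zero]
  have ht1 := ht.2.trans hT1
  have ha := h.mono ht.2
  have hi := ha.duhamelIntegrable hp₂ hp₃ hM hb ht0 ht1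
  simp only [duhamel, coeff_L2_sub, coeff_heat_coeff ht0.le, Pi.sub_apply,
    coeff_integral_heat ht0 ht1 hi.1 (fun s => isHermitianSeq_fluxSource p (G s))
      (ha.norm_fluxSource_le hp₂.le hp₃.le hM),
    coeff_integral_heat ht0 ht1 hi.2 (fun s => isHermitianSeq_transportSource (v s) (G s))
      ha.norm_transportSource_le]

/-- Frequencies in a finite box. -/
noncomputable def freqBox (n : ℕ) : Finset (Fin 2 → ℤ) := Fintype.piFinset fun _ => Finset.Icc (-n : ℤ) n

theorem le_freq_of_notMem_freqBox {n : ℕ} {k : Fin 2 → ℤ} (hk : k ∉ freqBox n) :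
    (n : ℝ) ≤ freq k := by
  simp only [freqBox, Fintype.mem_piFinset, Finset.mem_Icc, not_forall] at hk
  obtain ⟨j, hj⟩ := hk
  have h1 : (n : ℤ) ≤ |k j| := by
    rw [← abs_le, not_le] at hj
    exact hj.le
  have h2 : (n : ℝ) ≤ |(k j : ℝ)| := by exact_mod_cast h1
  have h3 := two_pi_abs_le_freq k j
  have := Real.pi_gt_three
  nlinarith [abs_nonneg (k j : ℝ)]

/-- Outside the box all frequencies are at least `n`, so the gradient bound controls the tail. This
compactness upgrades convergence of coefficients to convergence in `L²`. -/
theorem GradBound.norm_sq_le {z : L2} {K : ℝ} (h : GradBound z K) {n : ℕ} (hn : 0 < n) :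
    ‖z‖ ^ 2 ≤ ∑ k ∈ freqBox n, ‖coeff z k‖ ^ 2 + (K / n) ^ 2 := by
  classical
  have hn' : (0 : ℝ) < n := by exact_mod_cast hn
  have h0 : 0 ≤ ∑ k ∈ freqBox n, ‖coeff z k‖ ^ 2 + (K / n) ^ 2 := by positivity
  have key : ‖invFourier (coeff z)‖ ≤ √(∑ k ∈ freqBox n, ‖coeff z k‖ ^ 2 + (K / n) ^ 2) := by
    refine norm_invFourier_le (Real.sqrt_nonneg _) fun S => ?_
    rw [Real.sq_sqrt h0, ← Finset.sum_filter_add_sum_filter_not S (· ∈ freqBox n)]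
    gcongr
    · intro k hk
      exact (Finset.mem_filter.1 hk).2
    · rw [div_pow, le_div_iff₀ (by positivity), Finset.sum_mul]
      refine le_trans (Finset.sum_le_sum fun k hk => ?_)
        ((gradBound_iff h.nonneg).1 h (S.filter (· ∉ freqBox n)))
      rw [← mul_pow, mul_comm]
      gcongr
      exact le_freq_of_notMem_freqBox (Finset.mem_filter.1 hk).2
  rw [invFourier_coeff] at key
  calc ‖z‖ ^ 2 ≤ _ := pow_le_pow_left₀ (norm_nonneg _) key 2
    _ = _ := Real.sq_sqrt h0

theorem GradBound.neg {z : L2} {K : ℝ} (h : GradBound z K) : GradBound (-z) K := fun S => by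
  rw [map_neg, norm_neg]
  exact h S

theorem GradBound.sub {z z' : L2} {K K' : ℝ} (h : GradBound z K) (h' : GradBound z' K') :
    GradBound (z - z') (K + K') := by
  rw [sub_eq_add_neg]
  exact h.add h'.neg

/-- Bounded gradients and continuous Fourier coefficients imply continuity in `L²`. -/
theorem continuousWithinAt_of_gradBound {z : ℝ → L2} {I : Set ℝ} {K t₀ : ℝ} (ht₀ : t₀ ∈ I)
    (hc : ∀ k, ContinuousWithinAt (fun t => coeff (z t) k) I t₀)
    (hK : ∀ t ∈ I, GradBound (z t) K) : ContinuousWithinAt z I t₀ := by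
  rw [ContinuousWithinAt, tendsto_iff_norm_sub_tendsto_zero]
  have hsq : Tendsto (fun t => ‖z t - z t₀‖ ^ 2) (𝓝[I] t₀) (𝓝 0) := by
    rw [tendsto_order]
    refine ⟨fun a ha => Eventually.of_forall fun t => ha.trans_le (by positivity), fun e he => ?_⟩
    have hlim : Tendsto (fun n : ℕ => ((K + K) / n) ^ 2) atTop (𝓝 0) := by
      simpa using (tendsto_const_div_atTop_nhds_zero_nat (K + K)).pow 2
    -- The box is chosen uniformly in `t`, before `t` approaches `t₀`; `K + K` bounds the gradient
    -- of the difference.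
    obtain ⟨n, hn1, hn⟩ :=
      ((hlim.eventually (gt_mem_nhds (half_pos he))).and (eventually_gt_atTop 0)).exists
    have hsum : Tendsto (fun t => ∑ k ∈ freqBox n, ‖coeff (z t - z t₀ : L2) k‖ ^ 2) (𝓝[I] t₀)
        (𝓝 0) := by
      have : Tendsto (fun t => ∑ k ∈ freqBox n, ‖coeff (z t) k - coeff (z t₀) k‖ ^ 2) (𝓝[I] t₀)
          (𝓝 (∑ k ∈ freqBox n, ‖coeff (z t₀) k - coeff (z t₀) k‖ ^ 2)) :=
        tendsto_finsetSum _ fun k _ => (((hc k).sub tendsto_const_nhds).norm.pow 2)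
      simp only [sub_self, norm_zero, zero_pow two_ne_zero, Finset.sum_const_zero] at this
      simpa only [coeff_L2_sub] using this
    filter_upwards [hsum.eventually (gt_mem_nhds (half_pos he)), self_mem_nhdsWithin] with t h1 ht
    have := ((hK t ht).sub (hK t₀ ht₀)).norm_sq_le hn
    linarith
  have := hsq.sqrt
  simpa using this

/-- With `x = t^(1/4) freq k`, the multiplier bound is `x ≤ 1 + x⁴ ≤ e^{x⁴}`. -/
theorem gradBound_heat_coeff (ht : 0 < t) (u : L2) :
    GradBound (heat t (coeff u)) (‖u‖ * t ^ (-(1 / 4) : ℝ)) := by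
  have ht4 : 0 < t ^ (1 / 4 : ℝ) := Real.rpow_pos_of_pos ht _
  rw [gradBound_iff (mul_nonneg (norm_nonneg _) (Real.rpow_nonneg ht.le _))]
  intro S
  have hmul : ∀ k, freq k * Real.exp (-t * bilaplacianSymbol k) ≤ t ^ (-(1 / 4) : ℝ) := fun k => by
    set q := t ^ (1 / 4 : ℝ)
    have hq4 : q ^ 4 = t := by
      rw [← Real.rpow_natCast, ← Real.rpow_mul ht.le]; norm_num
    have hx : 0 ≤ q * freq k := mul_nonneg ht4.le (freq_nonneg k)
    have h1 : q * freq k ≤ Real.exp (t * bilaplacianSymbol k) := by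
      have h2 : t * bilaplacianSymbol k = (q * freq k) ^ 4 := by
        rw [bilaplacianSymbol_eq, mul_pow, hq4]
      have h3 := Real.add_one_le_exp (t * bilaplacianSymbol k)
      rw [h2] at h3 ⊢
      nlinarith [sq_nonneg (q * freq k - 1), sq_nonneg ((q * freq k) ^ 2 - 1)]
    rw [Real.rpow_neg ht.le, neg_mul, Real.exp_neg, ← div_eq_mul_inv, div_le_iff₀ (Real.exp_pos _),
      ← div_eq_inv_mul, le_div_iff₀ ht4, mul_comm]
    exact h1
  calc _ ≤ ∑ k ∈ S, (t ^ (-(1 / 4) : ℝ)) ^ 2 * ‖coeff u k‖ ^ 2 := by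
        refine Finset.sum_le_sum fun k _ => ?_
        rw [coeff_heat_coeff ht.le, norm_mul, norm_ofReal_exp, ← mul_assoc, mul_pow]
        have := freq_nonneg k
        gcongr
        exact hmul k
    _ ≤ _ := by
        rw [← Finset.mul_sum, mul_pow, mul_comm]
        gcongr
        exact sum_norm_coeff_le u S

end Admissible

end ThinFilm

namespace ThinFilm

open UnitAddTorus Filter Topology

/-! ### The fixed point -/

theorem gradCoeff_sub (j : Fin 2) (z w : L2) :
    gradCoeff j (z - w) = fun k => gradCoeff j z k - gradCoeff j w k := by
  ext k
  rw [gradCoeff, gradCoeff, gradCoeff, coeff_L2_sub]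
  ring

/-- The bounds make the coefficient sequences square summable, as additivity of `invFourier`
requires: a divergent `tsum` has a default value. -/
theorem GradBound.gradOf_sub {z w : L2} {K K' : ℝ} (h : GradBound z K) (h' : GradBound w K') :
    gradOf (z - w) = gradOf z - gradOf w := by
  rw [gradOf, gradOf, gradOf, ← Finset.sum_sub_distrib]
  refine Finset.sum_congr rfl fun j _ => ?_
  rw [gradCoeff_sub, invFourier_sub (summable_of_sum_le (h.sum_gradCoeff_le j))
    (summable_of_sum_le (h'.sum_gradCoeff_le j)), map_sub]

theorem aestronglyMeasurable_gradOf {μ : Measure ℝ} {z : ℝ → L2} {K : ℝ → ℝ}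
    (hz : ∀ k, AEStronglyMeasurable (fun t => coeff (z t) k) μ)
    (hK : ∀ᵐ t ∂μ, GradBound (z t) (K t)) : AEStronglyMeasurable (fun t => gradOf (z t)) μ := by
  refine Finset.aestronglyMeasurable_fun_sum _ fun j _ => ?_
  refine (axisCLM j).continuous.comp_aestronglyMeasurable
    (aestronglyMeasurable_invFourier (fun k => (hz k).const_mul _) ?_)
  filter_upwards [hK] with t ht
  exact summable_of_sum_le (ht.sum_gradCoeff_le j)

theorem heat_zero_source (r : ℝ) : heat r 0 = 0 := by
  refine norm_le_zero_iff.1 (norm_invFourier_le le_rfl fun S => ?_)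
  simp

theorem duhamel_zero_gradient (p : ℝ) (v : ℝ → L2Vec) (u₀ : L2) (t : ℝ) :
    duhamel p v u₀ (fun _ => 0) t = heat t (coeff u₀) := by
  simp [duhamel, fluxSource_zero, transportSource_zero, heat_zero_source]

/-- The standing assumptions of the fixed point argument. -/
structure Setting (p b M l T : ℝ) (v : ℝ → L2Vec) (u₀ : L2) : Prop where
  two_lt : 2 < p
  lt_three : p < 3
  M_pos : 0 < M
  b_nonneg : 0 ≤ b
  l_pos : 0 < l
  T_pos : 0 < T
  T_le : T ≤ 1
  coreConst_le : coreConst p b M * l ^ (-((3 - p) / 4)) ≤ 1 / 16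
  exp_le : Real.exp (l * T) ≤ 2
  norm_le : 4 * ‖u₀‖ ≤ M
  aesm_velocity : AEStronglyMeasurable v (volume.restrict (Ioc 0 T))
  norm_velocity_le : ∀ᵐ s ∂(volume.restrict (Ioc 0 T)), ‖v s‖ ≤ b

/-- The ball in which the fixed point is found. -/
structure InBall (M T : ℝ) (G : ℝ → L2Vec) : Prop where
  aesm : AEStronglyMeasurable G (volume.restrict (Ioc 0 T))
  norm_le : ∀ s ∈ Ioc 0 T, ‖G s‖ ≤ M * s ^ (-(1 / 4) : ℝ)

section Setting

variable {p b M l T t : ℝ} {v G H : ℝ → L2Vec} {u₀ : L2}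

theorem Setting.admissible (hS : Setting p b M l T v u₀) (hG : InBall M T G) :
    Admissible v b M T G :=
  ⟨hS.aesm_velocity, hS.norm_velocity_le, hG.aesm,
    (ae_restrict_iff' measurableSet_Ioc).2 (ae_of_all _ hG.norm_le)⟩

theorem Setting.inBall_zero (hS : Setting p b M l T v u₀) : InBall M T (fun _ => (0 : L2Vec)) :=
  ⟨aestronglyMeasurable_const, fun s hs => by
    rw [norm_zero]
    exact mul_nonneg hS.M_pos.le (Real.rpow_nonneg hs.1.le _)⟩

theorem Setting.gradBound_sub (hS : Setting p b M l T v u₀) {K : ℝ} (hK : 0 ≤ K)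
    (hG : Admissible v b M T G) (hH : Admissible v b M T H)
    (hGH : ∀ᵐ s ∂(volume.restrict (Ioc 0 T)),
      ‖G s - H s‖ ≤ K * Real.exp (l * s) * s ^ (-(1 / 4) : ℝ)) (ht : t ∈ Ioc 0 T) :
    GradBound (duhamel p v u₀ G t - duhamel p v u₀ H t)
      (1 / 16 * (K * Real.exp (l * t) * t ^ (-(1 / 4) : ℝ))) := by
  have ht1 := ht.2.trans hS.T_le
  have hG' := hG.mono ht.2
  have hH' := hH.mono ht.2
  have hd := fun {G} (h : Admissible v b M t G) =>
    h.duhamelIntegrable hS.two_lt hS.lt_three hS.M_pos hS.b_nonneg ht.1 ht1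
  have h0 : 0 ≤ t ^ (-(1 / 4) : ℝ) := Real.rpow_nonneg ht.1.le _
  refine (gradBound_duhamel_sub hS.two_lt hS.lt_three hS.M_pos hK hS.b_nonneg hS.l_pos ht.1 ht1
    (hd hG') (hd hH') hG'.norm_velocity_le hG'.norm_le hH'.norm_le
    (ae_mono (Measure.restrict_mono_set _ (Ioc_subset_Ioc (le_refl (0 : ℝ)) ht.2)) hGH)).mono ?_
  gcongr
  exact hS.coreConst_le

theorem Setting.gradBound_duhamel (hS : Setting p b M l T v u₀) (hG : InBall M T G)
    (ht : t ∈ Ioc 0 T) : GradBound (duhamel p v u₀ G t) (M / 2 * t ^ (-(1 / 4) : ℝ)) := by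
  have hM := hS.M_pos
  -- Comparison with the zero field, for which the Duhamel operator is the free evolution of `u₀`.
  have h1 := hS.gradBound_sub (t := t) hM.le (hS.admissible hG) (hS.admissible hS.inBall_zero)
    (by
      rw [ae_restrict_iff' measurableSet_Ioc]
      refine ae_of_all _ fun s hs => ?_
      rw [sub_zero]
      have h0 : 0 ≤ s ^ (-(1 / 4) : ℝ) := Real.rpow_nonneg hs.1.le _
      refine (hG.norm_le s hs).trans ?_
      gcongr
      exact le_mul_of_one_le_right hM.le (Real.one_le_exp (mul_nonneg hS.l_pos.le hs.1.le))) ht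
  rw [duhamel_zero_gradient] at h1
  have h2 := h1.add (gradBound_heat_coeff ht.1 u₀)
  rw [sub_add_cancel] at h2
  refine h2.mono ?_
  have h0 : 0 ≤ t ^ (-(1 / 4) : ℝ) := Real.rpow_nonneg ht.1.le _
  have h3 : Real.exp (l * t) ≤ 2 := le_trans
    (Real.exp_le_exp.2 (mul_le_mul_of_nonneg_left ht.2 hS.l_pos.le)) hS.exp_le
  have h4 := hS.norm_le
  -- The total is `M/8 + M/4`, below `M/2`; the target is `M/2` rather than `M` because `gradOf`
  -- loses a factor `2`.
  calc _ ≤ 1 / 16 * (M * 2 * t ^ (-(1 / 4) : ℝ)) + M / 4 * t ^ (-(1 / 4) : ℝ) := by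
        gcongr
        linarith
    _ ≤ _ := by nlinarith

theorem Setting.inBall_gradOf (hS : Setting p b M l T v u₀) (hG : InBall M T G) :
    InBall M T fun t => gradOf (duhamel p v u₀ G t) where
  aesm := by
    refine aestronglyMeasurable_gradOf (K := fun t => M / 2 * t ^ (-(1 / 4) : ℝ)) (fun k => ?_) ?_
    · exact (((hS.admissible hG).continuousOn_coeff hS.two_lt hS.lt_three hS.M_pos hS.b_nonneg
        hS.T_pos hS.T_le k).mono Ioc_subset_Icc_self).aestronglyMeasurable measurableSet_Ioc
    · rw [ae_restrict_iff' measurableSet_Ioc]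
      exact ae_of_all _ fun t ht => hS.gradBound_duhamel hG ht
  norm_le t ht := (hS.gradBound_duhamel hG ht).norm_gradOf_le.trans_eq (by ring)

theorem Setting.norm_gradOf_sub_le (hS : Setting p b M l T v u₀) {K : ℝ} (hK : 0 ≤ K)
    (hG : InBall M T G) (hH : InBall M T H)
    (hGH : ∀ s ∈ Ioc 0 T, ‖G s - H s‖ ≤ K * Real.exp (l * s) * s ^ (-(1 / 4) : ℝ))
    (ht : t ∈ Ioc 0 T) :
    ‖gradOf (duhamel p v u₀ G t) - gradOf (duhamel p v u₀ H t)‖ ≤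
      K / 2 * Real.exp (l * t) * t ^ (-(1 / 4) : ℝ) := by
  have h := hS.gradBound_sub (t := t) hK (hS.admissible hG) (hS.admissible hH)
    ((ae_restrict_iff' measurableSet_Ioc).2 (ae_of_all _ hGH)) ht
  rw [← (hS.gradBound_duhamel hG ht).gradOf_sub (hS.gradBound_duhamel hH ht)]
  refine h.norm_gradOf_le.trans ?_
  have h0 : 0 ≤ K * Real.exp (l * t) * t ^ (-(1 / 4) : ℝ) :=
    mul_nonneg (mul_nonneg hK (Real.exp_pos _).le) (Real.rpow_nonneg ht.1.le _)
  linarith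

/-- The Picard iterates of the gradient. -/
noncomputable def picard (p : ℝ) (v : ℝ → L2Vec) (u₀ : L2) : ℕ → ℝ → L2Vec
  | 0 => fun _ => 0
  | n + 1 => fun t => gradOf (duhamel p v u₀ (picard p v u₀ n) t)

theorem Setting.inBall_picard (hS : Setting p b M l T v u₀) (n : ℕ) :
    InBall M T (picard p v u₀ n) := by
  induction n with
  | zero => exact hS.inBall_zero
  | succ n ih => exact hS.inBall_gradOf ih

theorem Setting.norm_picard_sub_le (hS : Setting p b M l T v u₀) (n : ℕ) :
    ∀ s ∈ Ioc 0 T, ‖picard p v u₀ n s - picard p v u₀ (n + 1) s‖ ≤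
      M * (1 / 2) ^ n * Real.exp (l * s) * s ^ (-(1 / 4) : ℝ) := by
  have hM := hS.M_pos
  induction n with
  | zero =>
    intro s hs
    have h0 : 0 ≤ s ^ (-(1 / 4) : ℝ) := Real.rpow_nonneg hs.1.le _
    rw [picard, zero_sub, norm_neg, pow_zero, mul_one]
    refine ((hS.inBall_picard 1).norm_le s hs).trans ?_
    gcongr
    exact le_mul_of_one_le_right hM.le (Real.one_le_exp (mul_nonneg hS.l_pos.le hs.1.le))
  | succ n ih =>
    intro s hs
    refine (hS.norm_gradOf_sub_le (by positivity) (hS.inBall_picard n)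
      (hS.inBall_picard (n + 1)) ih hs).trans_eq ?_
    rw [pow_succ]
    ring

/-- The iterates converge geometrically at each time separately, so the limit is taken pointwise in
`L²`, and the ball and measurability pass to it. The same contraction estimate lets the limit pass
through the Duhamel operator. -/
theorem Setting.exists_fixedPoint (hS : Setting p b M l T v u₀) :
    ∃ G, InBall M T G ∧ ∀ t ∈ Ioc 0 T, G t = gradOf (duhamel p v u₀ G t) := by
  have hM := hS.M_pos
  have hdist : ∀ s ∈ Ioc 0 T, ∀ n, dist (picard p v u₀ n s) (picard p v u₀ (n + 1) s) ≤
      (M * Real.exp (l * s) * s ^ (-(1 / 4) : ℝ)) * (1 / 2) ^ n := fun s hs n => by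
    rw [dist_eq_norm]
    exact (hS.norm_picard_sub_le n s hs).trans_eq (by ring)
  set G : ℝ → L2Vec := fun t => limUnder atTop fun n => picard p v u₀ n t
  have hlim : ∀ s ∈ Ioc 0 T, Tendsto (fun n => picard p v u₀ n s) atTop (𝓝 (G s)) := fun s hs =>
    (cauchySeq_of_le_geometric _ _ (by norm_num) (hdist s hs)).tendsto_limUnder
  have hlim' : ∀ n, ∀ s ∈ Ioc 0 T, ‖picard p v u₀ n s - G s‖ ≤
      2 * M * (1 / 2) ^ n * Real.exp (l * s) * s ^ (-(1 / 4) : ℝ) := fun n s hs => by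
    rw [← dist_eq_norm]
    refine (dist_le_of_le_geometric_of_tendsto _ _ (by norm_num) (hdist s hs)
      (hlim s hs) n).trans_eq ?_
    ring
  have hG : InBall M T G :=
    { aesm := aestronglyMeasurable_of_tendsto_ae atTop (fun n => (hS.inBall_picard n).aesm)
        ((ae_restrict_iff' measurableSet_Ioc).2 (ae_of_all _ hlim))
      norm_le := fun s hs => le_of_tendsto (hlim s hs).norm
        (Eventually.of_forall fun n => (hS.inBall_picard n).norm_le s hs) }
  refine ⟨G, hG, fun t ht => ?_⟩
  refine tendsto_nhds_unique ((hlim t ht).comp (tendsto_add_atTop_nat 1)) ?_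
  rw [tendsto_iff_norm_sub_tendsto_zero]
  have hpow : Tendsto (fun n : ℕ => 2 * M * (1 / 2 : ℝ) ^ n / 2 * Real.exp (l * t) *
      t ^ (-(1 / 4) : ℝ)) atTop (𝓝 (2 * M * 0 / 2 * Real.exp (l * t) * t ^ (-(1 / 4) : ℝ))) :=
    ((((tendsto_pow_atTop_nhds_zero_of_lt_one (by norm_num) (by norm_num)).const_mul _).div_const
      _).mul_const _).mul_const _
  simp only [mul_zero, zero_div, zero_mul] at hpow
  exact squeeze_zero (fun _ => norm_nonneg _) (fun n => hS.norm_gradOf_sub_le (by positivity)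
    (hS.inBall_picard n) hG (hlim' n) ht) hpow

end Setting

end ThinFilm

namespace ThinFilm

open UnitAddTorus Filter Topology

/-! ### Existence -/

theorem divSemigroup_congr {p r : ℝ} {g : Torus2 → Plane} {G : L2Vec} (h : g =ᵐ[volume] G) :
    divSemigroup r (fun x => flux p (g x)) = heat r (fluxSource p G) := by
  rw [← divSemigroup_eq_heat, divSemigroup, divSemigroup]
  have hc : ∀ j k, coeff (fun x => flux p (g x) j) k = coeff (fun x => flux p (G x) j) k :=
    fun j k => coeff_congr (h.mono fun x hx => by rw [hx]) k
  simp only [hc]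

theorem semigroup_congr {r : ℝ} {V G : L2Vec} {g : Torus2 → Plane} (h : g =ᵐ[volume] G) :
    semigroup r (fun x => inner ℝ (V x) (g x)) = heat r (transportSource V G) := by
  rw [semigroup_eq_heat]
  congr 1
  ext k
  exact coeff_congr (h.mono fun x hx => by rw [hx]) k

theorem HasWeakGradient.congr_grad {f : Torus2 → ℝ} {g g' : Torus2 → Plane}
    (h : HasWeakGradient f g) (hg : g =ᵐ[volume] g') : HasWeakGradient f g' where
  integrable_fun := h.integrable_fun
  integrable_grad := h.integrable_grad.congr hg
  integral_eq φ hφ j := by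
    rw [h.integral_eq φ hφ j]
    congr 1
    refine integral_congr_ae ?_
    filter_upwards [hg] with x hx
    rw [hx]

/-- The inclusion `L²(𝕋²; ℝ²) → L¹(𝕋²; ℝ²)`. -/
noncomputable def toL1 (G : L2Vec) : L1Vec :=
  (memLp_one_iff_integrable.2 (integrable_L2Vec G)).toLp

theorem coeFn_toL1 (G : L2Vec) : toL1 G =ᵐ[volume] G := MemLp.coeFn_toLp _

theorem norm_toL1_le (G : L2Vec) : ‖toL1 G‖ ≤ ‖G‖ := by
  rw [L1.norm_eq_integral_norm]
  refine (integral_congr_ae ?_).trans_le (integral_norm_le G)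
  filter_upwards [coeFn_toL1 G] with x hx
  rw [hx]

theorem toL1_sub (G H : L2Vec) : toL1 G - toL1 H = toL1 (G - H) := by
  refine Lp.ext ?_
  filter_upwards [Lp.coeFn_sub (toL1 G) (toL1 H), coeFn_toL1 G, coeFn_toL1 H, coeFn_toL1 (G - H),
    Lp.coeFn_sub G H] with x h1 h2 h3 h4 h5
  rw [h1, h4, h5, Pi.sub_apply, Pi.sub_apply, h2, h3]

theorem continuous_toL1 : Continuous toL1 :=
  (LipschitzWith.mk_one fun G H => by
    rw [dist_eq_norm, dist_eq_norm, toL1_sub]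
    exact norm_toL1_le _).continuous

/-- Dominated convergence for the series `∑ |e^{-tλ(k)} - 1|² |û(k)|²`. -/
theorem tendsto_heat_coeff (u : L2) :
    Tendsto (fun t => heat t (coeff u)) (𝓝[≥] 0) (𝓝 u) := by
  rw [tendsto_iff_norm_sub_tendsto_zero]
  have hlim : Tendsto (fun t : ℝ => ∑' k, ‖((Real.exp (-t * bilaplacianSymbol k) : ℂ) - 1) *
      coeff u k‖ ^ 2) (𝓝[≥] 0) (𝓝 (∑' _ : Fin 2 → ℤ, 0)) := by
    refine tendsto_tsum_of_dominated_convergence (bound := fun k => (2 * ‖coeff u k‖) ^ 2) ?_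
      (fun k => ?_) ?_
    · simpa only [mul_pow] using (summable_coeff u).mul_left (2 ^ 2)
    · have hc : Continuous fun t : ℝ =>
          ‖((Real.exp (-t * bilaplacianSymbol k) : ℂ) - 1) * coeff u k‖ ^ 2 := by fun_prop
      have := hc.tendsto 0
      simp only [neg_zero, zero_mul, Real.exp_zero, Complex.ofReal_one, sub_self, norm_zero,
        zero_pow two_ne_zero] at this
      exact this.mono_left nhdsWithin_le_nhds
    · filter_upwards [self_mem_nhdsWithin] with t ht k
      rw [norm_pow, norm_norm, norm_mul]
      gcongr
      refine (norm_sub_le _ _).trans ?_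
      have := norm_exp_neg_le (mem_Ici.1 ht) k
      rw [norm_one]
      linarith
  rw [tsum_zero] at hlim
  have hs := hlim.sqrt
  rw [Real.sqrt_zero] at hs
  refine squeeze_zero' (Eventually.of_forall fun _ => norm_nonneg _) ?_ hs
  filter_upwards [self_mem_nhdsWithin] with t ht
  have h1 := summable_sq_mul (summable_coeff u) (norm_exp_neg_le (mem_Ici.1 ht))
  have h2 : Summable fun k => ‖((Real.exp (-t * bilaplacianSymbol k) : ℂ) - 1) *
      coeff u k‖ ^ 2 := by
    refine ((summable_coeff u).mul_left (2 ^ 2)).of_nonneg_of_le (fun _ => by positivity)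
      fun k => ?_
    rw [norm_mul, mul_pow]
    gcongr
    refine (norm_sub_le _ _).trans ?_
    have := norm_exp_neg_le (mem_Ici.1 ht) k
    rw [norm_one]
    linarith
  nth_rw 2 [← invFourier_coeff u]
  rw [heat, ← invFourier_sub h1 (summable_coeff u)]
  refine norm_invFourier_le (Real.sqrt_nonneg _) fun S => ?_
  rw [Real.sq_sqrt (tsum_nonneg fun _ => by positivity)]
  simp only [sub_mul, one_mul] at h2 ⊢
  exact h2.sum_le_tsum S fun _ _ => by positivity

section Existence

variable {p b M l T t : ℝ} {v G : ℝ → L2Vec} {u₀ : L2}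

/-- At `t = 0` the gradient bound blows up, and continuity comes from the semigroup and the
smallness of the integrals. At `t > 0` the gradient is bounded on `[t/2, T]` and continuity of the
coefficients suffices. -/
theorem Setting.continuousOn_duhamel (hS : Setting p b M l T v u₀) (hG : InBall M T G) :
    ContinuousOn (duhamel p v u₀ G) (Icc 0 T) := by
  intro t ht
  rcases ht.1.eq_or_lt with rfl | ht0
  · have h1 : Tendsto (fun t => heat t (coeff u₀)) (𝓝[Icc 0 T] 0) (𝓝 u₀) :=
      (tendsto_heat_coeff u₀).mono_left (nhdsWithin_mono _ fun s hs => hs.1)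
    have hpow : ∀ {e : ℝ}, 0 < e → Tendsto (fun t : ℝ => t ^ e) (𝓝[Icc 0 T] 0) (𝓝 0) := fun he => by
      have := (Real.continuous_rpow_const he.le).tendsto 0
      rw [Real.zero_rpow he.ne'] at this
      exact this.mono_left nhdsWithin_le_nhds
    have h2 : Tendsto (fun t => duhamel p v u₀ G t - heat t (coeff u₀)) (𝓝[Icc 0 T] 0) (𝓝 0) := by
      have hlim := (((hpow (show 0 < (3 - p) / 4 by linarith [hS.lt_three])).const_mul
        (betaConst (1 / 2) ((p - 1) / 4))).const_mul
        (8 * (2 * M) ^ (p - 2) * M * kernelConst 1)).add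
        (((hpow (show (0 : ℝ) < 1 / 2 by norm_num)).const_mul
        (betaConst (1 / 4) (1 / 4))).const_mul (b * M * kernelConst 0))
      simp only [mul_zero, add_zero] at hlim
      rw [tendsto_zero_iff_norm_tendsto_zero]
      refine squeeze_zero' (Eventually.of_forall fun _ => norm_nonneg _) ?_ hlim
      filter_upwards [self_mem_nhdsWithin] with s hs
      rcases hs.1.eq_or_lt with rfl | hs0
      · rw [duhamel_zero, heat_zero_coeff, sub_self, norm_zero,
          Real.zero_rpow (by linarith [hS.lt_three]), Real.zero_rpow (by norm_num)]
        simp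
      · exact ((hS.admissible hG).mono hs.2).norm_duhamel_sub_le hS.two_lt hS.lt_three hS.M_pos
          hS.b_nonneg hs0 (hs.2.trans hS.T_le)
    have h3 := h2.add h1
    simp only [sub_add_cancel, zero_add] at h3
    rw [ContinuousWithinAt, duhamel_zero]
    exact h3
  · have hmem : t ∈ Icc (t / 2) T := ⟨by linarith, ht.2⟩
    have hsub : Icc (t / 2) T ⊆ Icc 0 T := Icc_subset_Icc_left (by linarith)
    have h1 : ContinuousWithinAt (duhamel p v u₀ G) (Icc (t / 2) T) t := by
      refine continuousWithinAt_of_gradBound (K := M / 2 * (t / 2) ^ (-(1 / 4) : ℝ)) hmem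
        (fun k => ?_) fun s hs => ?_
      · exact ((hS.admissible hG).continuousOn_coeff hS.two_lt hS.lt_three hS.M_pos hS.b_nonneg
          hS.T_pos hS.T_le k t ht).mono hsub
      · have hM := hS.M_pos
        have hs0 : 0 < s := by linarith [hs.1]
        refine (hS.gradBound_duhamel hG ⟨hs0, hs.2⟩).mono ?_
        exact mul_le_mul_of_nonneg_left
          (Real.rpow_le_rpow_of_nonpos (by linarith) hs.1 (by norm_num)) (by positivity)
    refine h1.mono_of_mem_nhdsWithin ?_
    filter_upwards [self_mem_nhdsWithin,
      nhdsWithin_le_nhds (lt_mem_nhds (show t / 2 < t by linarith))] with s hs hs'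
    exact ⟨le_of_lt hs', hs.2⟩

theorem Setting.isMildSolution (hS : Setting p b M l T v u₀) (hG : InBall M T G)
    (hfix : ∀ t ∈ Ioc 0 T, G t = gradOf (duhamel p v u₀ G t)) :
    IsMildSolution p v u₀ T (duhamel p v u₀ G) where
  continuousOn := hS.continuousOn_duhamel hG
  duhamel := by
    refine ⟨fun s => toL1 (G s), ?_, ?_, ?_, ?_, ?_⟩
    · refine IntegrableOn.locallyIntegrableOn ?_
      rw [integrableOn_Icc_iff_integrableOn_Ioc]
      have hdom := (intervalIntegrable_rpow_neg (b := 1 / 4) (t := T) (by norm_num)).const_mul M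
      rw [intervalIntegrable_iff_integrableOn_Ioc_of_le hS.T_pos.le] at hdom
      refine Integrable.mono' hdom (continuous_toL1.comp_aestronglyMeasurable hG.aesm) ?_
      rw [ae_restrict_iff' measurableSet_Ioc]
      exact ae_of_all _ fun s hs => (norm_toL1_le _).trans (hG.norm_le s hs)
    · rw [← restrict_Ioc_eq_restrict_Icc, ae_restrict_iff' measurableSet_Ioc]
      refine ae_of_all _ fun s hs => ?_
      have h := (hS.gradBound_duhamel hG hs).hasWeakGradient
      rw [← hfix s hs] at h
      exact h.congr_grad (coeFn_toL1 _).symm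
    · refine ae_of_all _ fun s => ?_
      refine (integrable_flux hS.two_lt.le hS.lt_three.le (G s)).congr ?_
      filter_upwards [coeFn_toL1 (G s)] with x hx
      rw [hx]
    · refine ae_of_all _ fun s => ?_
      refine (integrable_inner (v s) (G s)).congr ?_
      filter_upwards [coeFn_toL1 (G s)] with x hx
      rw [hx]
    · intro t ht
      simp only [divSemigroup_congr (coeFn_toL1 _), semigroup_congr (coeFn_toL1 _)]
      have hi : DuhamelIntegrable p v G t := by
        rcases ht.1.eq_or_lt with rfl | ht0
        · exact ⟨IntervalIntegrable.refl, IntervalIntegrable.refl⟩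
        · exact ((hS.admissible hG).mono ht.2).duhamelIntegrable hS.two_lt hS.lt_three hS.M_pos
            hS.b_nonneg ht0 (ht.2.trans hS.T_le)
      exact ⟨hi.1, hi.2, rfl⟩

theorem rpow_mul_rpow_neg_quarter (ht : 0 < t) :
    t ^ (1 / 4 : ℝ) * t ^ (-(1 / 4) : ℝ) = 1 := by
  rw [← Real.rpow_add ht]
  norm_num

theorem Setting.memWeightedSpace (hS : Setting p b M l T v u₀) (hG : InBall M T G) :
    MemWeightedSpace T (duhamel p v u₀ G) := by
  refine ⟨hS.continuousOn_duhamel hG, ⟨M, hS.M_pos.le⟩, fun t ht => ?_⟩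
  have h := hS.gradBound_duhamel hG ht
  refine ⟨_, h.hasWeakGradient, ?_⟩
  have hn : ‖gradOf (duhamel p v u₀ G t)‖ ≤ M * t ^ (-(1 / 4) : ℝ) :=
    (hS.inBall_gradOf hG).norm_le t ht
  have ht4 : 0 ≤ t ^ (1 / 4 : ℝ) := Real.rpow_nonneg ht.1.le _
  rw [← ENNReal.ofReal_toReal (Lp.memLp (gradOf (duhamel p v u₀ G t))).eLpNorm_ne_top,
    ← Lp.norm_def, ← ENNReal.ofReal_mul ht4]
  have h2 : t ^ (1 / 4 : ℝ) * ‖gradOf (duhamel p v u₀ G t)‖ ≤ M := by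
    calc _ ≤ t ^ (1 / 4 : ℝ) * (M * t ^ (-(1 / 4) : ℝ)) := by gcongr
      _ = M * (t ^ (1 / 4 : ℝ) * t ^ (-(1 / 4) : ℝ)) := by ring
      _ = M := by rw [rpow_mul_rpow_neg_quarter ht.1, mul_one]
  refine (ENNReal.ofReal_le_ofReal h2).trans_eq ?_
  rw [ENNReal.ofReal_eq_coe_nnreal hS.M_pos.le]
  rfl

end Existence

/-! ### Uniqueness -/

section Uniqueness

variable {p b T : ℝ} {v : ℝ → L2Vec} {u₀ : L2}

/-- A mild solution in the weighted space is given by the Duhamel operator applied to its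
square integrable gradient. -/
theorem exists_gradient_of_isMildSolution {w : ℝ → L2} (hw : IsMildSolution p v u₀ T w)
    (hm : MemWeightedSpace T w) : ∃ (H : ℝ → L2Vec) (M : ℝ), 0 ≤ M ∧
      (∀ᵐ s ∂(volume.restrict (Ioc 0 T)), ‖H s‖ ≤ M * s ^ (-(1 / 4) : ℝ)) ∧
      (∀ᵐ s ∂(volume.restrict (Ioc 0 T)), HasWeakGradient (w s) (H s)) ∧
      ∀ t ∈ Icc 0 T, DuhamelIntegrable p v H t ∧ w t = duhamel p v u₀ H t := by
  classical
  obtain ⟨-, M, hM⟩ := hm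
  obtain ⟨G, -, hgrad, -, -, hduh⟩ := hw.duhamel
  rw [← restrict_Ioc_eq_restrict_Icc] at hgrad
  -- The default value `0` is taken only on a null set of times.
  let H : ℝ → L2Vec := fun s => if h : MemLp (G s) 2 volume then h.toLp else 0
  have hae : ∀ᵐ s ∂(volume.restrict (Ioc 0 T)), G s =ᵐ[volume] H s ∧
      ‖H s‖ ≤ M * s ^ (-(1 / 4) : ℝ) := by
    filter_upwards [hgrad, ae_restrict_mem measurableSet_Ioc] with s hs hs0
    obtain ⟨g, hg, hgM⟩ := hM s hs0
    -- The integrable gradient of the mild formulation and the square integrable one of the weighted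
    -- space have the same Fourier coefficients.
    have heq : G s =ᵐ[volume] g := vectorField_ae_eq_of_coeff hs.integrable_grad
      hg.integrable_grad fun j k => by rw [hs.coeff_eq, hg.coeff_eq]
    rw [← eLpNorm_congr_ae heq] at hgM
    have hs4 : 0 < s ^ (1 / 4 : ℝ) := Real.rpow_pos_of_pos hs0.1 _
    have hfin : eLpNorm (G s) 2 volume ≠ ⊤ := by
      intro htop
      rw [htop, ENNReal.mul_top (by simpa using hs4)] at hgM
      exact absurd hgM (by simp)
    have hmem : MemLp (G s) 2 volume := ⟨hs.integrable_grad.aestronglyMeasurable, hfin.lt_top⟩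
    have hH : H s = hmem.toLp := dif_pos hmem
    rw [hH]
    refine ⟨hmem.coeFn_toLp.symm, ?_⟩
    rw [Lp.norm_toLp]
    have h1 := ENNReal.toReal_mono ENNReal.coe_ne_top hgM
    rw [ENNReal.toReal_mul, ENNReal.toReal_ofReal hs4.le, ENNReal.coe_toReal] at h1
    calc _ = (s ^ (1 / 4 : ℝ) * s ^ (-(1 / 4) : ℝ)) * (eLpNorm (G s) 2 volume).toReal := by
          rw [rpow_mul_rpow_neg_quarter hs0.1, one_mul]
      _ = (s ^ (1 / 4 : ℝ) * (eLpNorm (G s) 2 volume).toReal) * s ^ (-(1 / 4) : ℝ) := by ring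
      _ ≤ M * s ^ (-(1 / 4) : ℝ) := by
          have := Real.rpow_nonneg hs0.1.le (-(1 / 4) : ℝ)
          gcongr
  refine ⟨H, M, M.2, hae.mono fun s hs => hs.2, ?_, fun t ht => ?_⟩
  · filter_upwards [hgrad, hae] with s h1 h2
    exact h1.congr_grad h2.1
  · obtain ⟨hi1, hi2, hwt⟩ := hduh t ht
    have hae' : ∀ᵐ s ∂(volume.restrict (uIoc 0 t)), G s =ᵐ[volume] H s := by
      rw [uIoc_of_le ht.1]
      exact ae_mono (Measure.restrict_mono_set _ (Ioc_subset_Ioc (le_refl (0 : ℝ)) ht.2))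
        (hae.mono fun s hs => hs.1)
    have e1 : (fun s => divSemigroup (t - s) (fun x => flux p (G s x))) =ᵐ[volume.restrict
        (uIoc 0 t)] fun s => heat (t - s) (fluxSource p (H s)) :=
      hae'.mono fun s hs => divSemigroup_congr hs
    have e2 : (fun s => semigroup (t - s) (fun x => inner ℝ (v s x) (G s x))) =ᵐ[volume.restrict
        (uIoc 0 t)] fun s => heat (t - s) (transportSource (v s) (H s)) :=
      hae'.mono fun s hs => semigroup_congr hs
    refine ⟨⟨hi1.congr_ae e1, hi2.congr_ae e2⟩, ?_⟩
    rw [hwt, duhamel, semigroup_eq_heat,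
      intervalIntegral.integral_congr_ae ((ae_restrict_iff' measurableSet_uIoc).1 e1),
      intervalIntegral.integral_congr_ae ((ae_restrict_iff' measurableSet_uIoc).1 e2)]

theorem exists_coreConst_mul_rpow_le (p b M : ℝ) (hp₃ : p < 3) {e : ℝ} (he : 0 < e) :
    ∃ l, 0 < l ∧ coreConst p b M * l ^ (-((3 - p) / 4)) ≤ e := by
  have h := (tendsto_rpow_neg_atTop (show 0 < (3 - p) / 4 by linarith)).const_mul (coreConst p b M)
  rw [mul_zero] at h
  obtain ⟨l, h1, h2⟩ := ((h.eventually (gt_mem_nhds he)).and (eventually_gt_atTop 0)).exists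
  exact ⟨l, h2, h1.le⟩

theorem sub_eq_gradOf_sub {z w : L2} {G H : L2Vec} {K : ℝ} (hG : HasWeakGradient z G)
    (hH : HasWeakGradient w H) (hK : GradBound (z - w) K) : G - H = gradOf (z - w) := by
  refine Lp.ext (vectorField_ae_eq_of_coeff (integrable_L2Vec _) (integrable_L2Vec _)
    fun j k => ?_)
  have h1 : (fun x => (G - H : L2Vec) x j) =ᵐ[volume] fun x => G x j - H x j := by
    filter_upwards [Lp.coeFn_sub G H] with x hx
    rw [hx]
    rfl
  rw [coeff_congr h1, coeff_sub (hG.integrable_apply j) (hH.integrable_apply j), hG.coeff_eq,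
    hH.coeff_eq, hK.hasWeakGradient.coeff_eq, coeff_L2_sub, mul_sub]

/-- Uniqueness of mild solutions in the weighted space. -/
theorem eqOn_of_isMildSolution {w w' : ℝ → L2} (hp₂ : 2 < p) (hp₃ : p < 3) (hb : 0 ≤ b) (hT1 : T ≤ 1)
    (hv : ∀ᵐ s ∂(volume.restrict (Ioc 0 T)), ‖v s‖ ≤ b)
    (hw : IsMildSolution p v u₀ T w) (hm : MemWeightedSpace T w)
    (hw' : IsMildSolution p v u₀ T w') (hm' : MemWeightedSpace T w') : EqOn w w' (Icc 0 T) := by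
  obtain ⟨G, M₁, hM₁, hGM, hGw, hG⟩ := exists_gradient_of_isMildSolution hw hm
  obtain ⟨H, M₂, hM₂, hHM, hHw, hH⟩ := exists_gradient_of_isMildSolution hw' hm'
  set M := M₁ + M₂ + 1
  have hM : 0 < M := by positivity
  have hmono : ∀ {t}, t ≤ T → volume.restrict (Ioc 0 t) ≤ volume.restrict (Ioc 0 T) := fun ht =>
    Measure.restrict_mono_set _ (Ioc_subset_Ioc (le_refl (0 : ℝ)) ht)
  have hGM' : ∀ᵐ s ∂(volume.restrict (Ioc 0 T)), ‖G s‖ ≤ M * s ^ (-(1 / 4) : ℝ) := by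
    filter_upwards [hGM, ae_restrict_mem measurableSet_Ioc] with s hs hs0
    have := Real.rpow_nonneg hs0.1.le (-(1 / 4) : ℝ)
    refine hs.trans ?_
    gcongr
    simp only [M]; linarith
  have hHM' : ∀ᵐ s ∂(volume.restrict (Ioc 0 T)), ‖H s‖ ≤ M * s ^ (-(1 / 4) : ℝ) := by
    filter_upwards [hHM, ae_restrict_mem measurableSet_Ioc] with s hs hs0
    have := Real.rpow_nonneg hs0.1.le (-(1 / 4) : ℝ)
    refine hs.trans ?_
    gcongr
    simp only [M]; linarith
  -- `l` depends on the two solutions, but no smallness of `l * T` is needed: the weight merely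
  -- changes the norm. The value `1/4` and the factor `2` lost by `gradOf` give the contraction
  -- ratio `1/2`.
  obtain ⟨l, hl, hcore⟩ := exists_coreConst_mul_rpow_le p b M hp₃ (e := 1 / 4) (by norm_num)
  have key : ∀ n : ℕ, ∀ᵐ s ∂(volume.restrict (Ioc 0 T)),
      ‖G s - H s‖ ≤ 2 * M * (1 / 2) ^ n * Real.exp (l * s) * s ^ (-(1 / 4) : ℝ) := by
    intro n
    induction n with
    | zero =>
      filter_upwards [hGM', hHM', ae_restrict_mem measurableSet_Ioc] with s h1 h2 hs
      have h0 := Real.rpow_nonneg hs.1.le (-(1 / 4) : ℝ)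
      have he := Real.one_le_exp (mul_nonneg hl.le hs.1.le)
      have h3 : M * s ^ (-(1 / 4) : ℝ) ≤ M * s ^ (-(1 / 4) : ℝ) * Real.exp (l * s) :=
        le_mul_of_one_le_right (mul_nonneg hM.le h0) he
      refine (norm_sub_le _ _).trans ?_
      rw [pow_zero]
      linarith
    | succ n ih =>
      filter_upwards [hGw, hHw, ae_restrict_mem measurableSet_Ioc] with t h1 h2 ht
      -- Since both functions are their own Duhamel images, the estimate applied to the gradients
      -- bounds the gradient of `w - w'`, improving the previous bound.
      have hbd := gradBound_duhamel_sub (u₀ := u₀) (K := 2 * M * (1 / 2) ^ n) hp₂ hp₃ hM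
        (by positivity) hb hl ht.1 (ht.2.trans hT1) (hG t (Ioc_subset_Icc_self ht)).1
        (hH t (Ioc_subset_Icc_self ht)).1 (ae_mono (hmono ht.2) hv) (ae_mono (hmono ht.2) hGM')
        (ae_mono (hmono ht.2) hHM') (ae_mono (hmono ht.2) ih)
      rw [← (hG t (Ioc_subset_Icc_self ht)).2, ← (hH t (Ioc_subset_Icc_self ht)).2] at hbd
      rw [sub_eq_gradOf_sub h1 h2 hbd]
      refine hbd.norm_gradOf_le.trans ?_
      have h0 : 0 ≤ 2 * M * (1 / 2) ^ n * Real.exp (l * t) * t ^ (-(1 / 4) : ℝ) := by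
        have := Real.rpow_nonneg ht.1.le (-(1 / 4) : ℝ)
        positivity
      have h3 := mul_le_mul_of_nonneg_right hcore h0
      rw [pow_succ]
      linarith
  have hGH : ∀ᵐ s ∂(volume.restrict (Ioc 0 T)), G s = H s := by
    filter_upwards [ae_all_iff.2 key] with s hs
    have hpow : Tendsto (fun n : ℕ => 2 * M * (1 / 2 : ℝ) ^ n * Real.exp (l * s) *
        s ^ (-(1 / 4) : ℝ)) atTop (𝓝 (2 * M * 0 * Real.exp (l * s) * s ^ (-(1 / 4) : ℝ))) :=
      (((tendsto_pow_atTop_nhds_zero_of_lt_one (by norm_num) (by norm_num)).const_mul _).mul_const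
        _).mul_const _
    simp only [mul_zero, zero_mul] at hpow
    exact sub_eq_zero.1 (norm_le_zero_iff.1 (ge_of_tendsto' hpow hs))
  intro t ht
  have hGHt : ∀ᵐ s, s ∈ uIoc 0 t → G s = H s := by
    rw [uIoc_of_le ht.1, ← ae_restrict_iff' measurableSet_Ioc]
    exact ae_mono (hmono ht.2) hGH
  have e1 : ∫ s in (0 : ℝ)..t, heat (t - s) (fluxSource p (G s)) =
      ∫ s in (0 : ℝ)..t, heat (t - s) (fluxSource p (H s)) :=
    intervalIntegral.integral_congr_ae (hGHt.mono fun s hs hs' => by rw [hs hs'])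
  have e2 : ∫ s in (0 : ℝ)..t, heat (t - s) (transportSource (v s) (G s)) =
      ∫ s in (0 : ℝ)..t, heat (t - s) (transportSource (v s) (H s)) :=
    intervalIntegral.integral_congr_ae (hGHt.mono fun s hs hs' => by rw [hs hs'])
  rw [(hG t ht).2, (hH t ht).2, duhamel, duhamel, e1, e2]

end Uniqueness

/-! ### From the data to the standing assumptions. -/

theorem ae_norm_le_velocityNorm {v : ℝ → L2Vec} (hv : MemLp v ⊤ (volume.restrict (Ici (0 : ℝ)))) :
    ∀ᵐ s ∂(volume.restrict (Ici (0 : ℝ))), ‖v s‖ ≤ velocityNorm v := by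
  filter_upwards [ae_le_eLpNormEssSup (f := v) (μ := volume.restrict (Ici (0 : ℝ)))] with s hs
  rw [← eLpNorm_exponent_top] at hs
  have := ENNReal.toReal_mono hv.eLpNorm_ne_top hs
  simpa [velocityNorm] using this

end ThinFilm

theorem mainTheorem7 (p : ℝ) (hp₂ : 2 < p) (hp₃ : p < 3) (a b : ℝ) :
    ∃ T : ℝ, 0 < T ∧ T ≤ 1 ∧
      ∀ (u₀ : ThinFilm.L2) (v : ℝ → ThinFilm.L2Vec),
        MemLp v ∞ (volume.restrict (Ici (0 : ℝ))) →
        ‖u₀‖ = a → ThinFilm.velocityNorm v = b →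
        ∃ u : ℝ → ThinFilm.L2,
          ThinFilm.IsMildSolution p v u₀ T u ∧ ThinFilm.MemWeightedSpace T u ∧
          ∀ w : ℝ → ThinFilm.L2,
            ThinFilm.IsMildSolution p v u₀ T w → ThinFilm.MemWeightedSpace T w →
            EqOn w u (Icc 0 T) := by
  -- The radius `4|a| + 1` dominates `4‖u₀‖` and stays positive for `a = 0`. Absolute values give
  -- the needed signs before the data are introduced, so `l` and `T` depend on `p`, `a`, `b` alone.
  obtain ⟨l, hl, hcore⟩ := ThinFilm.exists_coreConst_mul_rpow_le p |b| (4 * |a| + 1) hp₃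
    (e := 1 / 16) (by norm_num)
  have hlog : 0 < Real.log 2 := Real.log_pos one_lt_two
  -- The bound `log 2 / l` is what `e^{lT} ≤ 2` requires; the bound `1` is needed by the smoothing
  -- estimates.
  refine ⟨min 1 (Real.log 2 / l), lt_min one_pos (div_pos hlog hl), min_le_left _ _, ?_⟩
  intro u₀ v hv ha hb
  set T := min 1 (Real.log 2 / l)
  have hsub : Ioc 0 T ⊆ Ici (0 : ℝ) := fun s hs => hs.1.le
  have hμ := Measure.restrict_mono_set (volume : Measure ℝ) hsub
  have hS : ThinFilm.Setting p |b| (4 * |a| + 1) l T v u₀ :=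
    { two_lt := hp₂
      lt_three := hp₃
      M_pos := by positivity
      b_nonneg := abs_nonneg b
      l_pos := hl
      T_pos := lt_min one_pos (div_pos hlog hl)
      T_le := min_le_left _ _
      coreConst_le := hcore
      exp_le := by
        rw [← Real.le_log_iff_exp_le two_pos, ← le_div_iff₀' hl]
        exact min_le_right _ _
      norm_le := by
        rw [ha]
        linarith [le_abs_self a]
      aesm_velocity := hv.aestronglyMeasurable.mono_measure hμ
      norm_velocity_le := by
        filter_upwards [ae_mono hμ (ThinFilm.ae_norm_le_velocityNorm hv)] with s hs
        rw [← hb]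
        exact hs.trans (le_abs_self _) }
  obtain ⟨G, hG, hfix⟩ := hS.exists_fixedPoint
  have hu := hS.isMildSolution hG hfix
  have hu' := hS.memWeightedSpace hG
  exact ⟨_, hu, hu', fun w hw hw' => ThinFilm.eqOn_of_isMildSolution hp₂ hp₃ hS.b_nonneg
    hS.T_le hS.norm_velocity_le hw hw' hu hu'⟩
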